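/- An instance of the stable marriage problem consists of $n$ men, $n$ women and a profile $\succ$, which contains for every agent a preference list, i.e. a strict total order on the agents of the other side. For a profile $\succ$ let $\mathrm{DA}(\succ)$ be the matching computed by the men-proposing deferred acceptance algorithm: in every round each unmatched man proposes to his favourite woman among those who have not rejected him yet, and each woman tentatively keeps her favourite proposal and rejects the others, until nobody is rejected. Fix a profile $\succ$ and a man $m$ (the accomplice), and let $\mu=\mathrm{DA}(\succ)$. For a list $\succ'_m$ of the women let $\mu'=\mathrm{DA}(\succ_{-m},\succ'_m)$ be the matching that results when $m$ reports $\succ'_m$ instead of his true list $\succ_m$. The list $\succ'_m$ is a *no-regret* strategy if $\mu'(m)\succ_m\mu(m)$ or $\mu'(m)=\mu(m)$. An *optimal one-for-all strategy* for $m$ is a no-regret strategy $\succ'_m$ such that every woman weakly prefers (according to her list in $\succ$) her partner in $\mu'$ to her partner in $\mu$, and also to her partner in $\mathrm{DA}(\succ_{-m},\succ''_m)$ for every no-regret strategy $\succ''_m$. A list arises from $\succ_m$ by *pushing up* a set $X$ of women if the women above $\mu(m)$ in it are those above $\mu(m)$ in $\succ_m$ together with those in $X\setminus\{\mu(m)\}$,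 the order within the part above $\mu(m)$ and within the part below $\mu(m)$ being arbitrary. Let $W^{\mathrm{NR}}$ be the set of all women $w$ such that pushing up $\{w\}$ (in whatever order) gives a no-regret strategy. **Theorem.** There is an algorithm which, given $n$, the $2n$ preference lists of a profile $\succ$ and a man $m$, computes in $O(n^3)$ time the set $W^{\mathrm{NR}}$ and a list $\succ'_m$ that arises from $\succ_m$ by pushing up $W^{\mathrm{NR}}$ and is an optimal one-for-all strategy for the accomplice $m$. Here running time is measured on a random access machine with unit-cost addition, truncated subtraction, multiplication, comparison and memory access, whose words are the integers from $0$ to $C n^2$ for a constant $C$ (words of $O(\log n)$ bits); the program and the constants do not depend on $n$, $\succ$ and $m$. -/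

import Mathlib

namespace OneForAll

/-! ### Stable marriage instances

The `n` men and the `n` women are both labelled by `Fin n`. -/

/-- A preference list (a strict total order on `n` agents): `l k` is the agent in position `k`,
position `0` being the most preferred one. -/
abbrev PrefList (n : ℕ) := Equiv.Perm (Fin n)

/-- `l.Prefers a b`: the list `l` ranks `a` strictly above `b`. -/
def PrefList.Prefers {n : ℕ} (l : PrefList n) (a b : Fin n) : Prop := l.symm a < l.symm b

/-- `l.WeakPrefers a b`: `a` is strictly above `b` in the list `l`, or `a = b`. -/
def PrefList.WeakPrefers {n : ℕ} (l : PrefList n) (a b : Fin n) : Prop := l.Prefers a b ∨ a = b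

/-- A preference profile: a list of women for every man, and a list of men for every woman. -/
structure Profile (n : ℕ) where
  men : Fin n → PrefList n
  women : Fin n → PrefList n

/-- The profile in which man `m` reports the list `σ` and nobody else changes their list. -/
def Profile.report {n : ℕ} (P : Profile n) (m : Fin n) (σ : PrefList n) : Profile n where
  men := Function.update P.men m σ
  women := P.women

/-! ### The men-proposing deferred acceptance algorithm

A state of the algorithm is the function `k` giving, for every man, the number of women who
have rejected him so far.  As a man proposes in the order of his list, these women are the first
`k m` women of his list, and his standing proposal is to the woman in position `k m`. -/

/-- In state `k` the standing proposal of man `m` is to woman `w`. -/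
def Proposes {n : ℕ} (P : Profile n) (k : Fin n → ℕ) (m w : Fin n) : Prop :=
  (((P.men m).symm w : Fin n) : ℕ) = k m

/-- In state `k` man `m` is rejected: the woman he proposes to has a proposal from a man
whom she prefers to `m`. -/
def IsRejected {n : ℕ} (P : Profile n) (k : Fin n → ℕ) (m : Fin n) : Prop :=
  ∃ w m', Proposes P k m w ∧ Proposes P k m' w ∧ (P.women w).Prefers m' m

open Classical in
/-- One round: every woman keeps her favourite proposal and rejects the other ones. -/
noncomputable def daRound {n : ℕ} (P : Profile n) (k : Fin n → ℕ) : Fin n → ℕ :=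
  fun m => if IsRejected P k m then k m + 1 else k m

/-- The state after `r` rounds, starting without any rejection. -/
noncomputable def daState {n : ℕ} (P : Profile n) (r : ℕ) : Fin n → ℕ := (daRound P)^[r] 0

/-- The terminal state. (Every round but the terminal ones has a new rejection, so that
`n * n` rounds are enough; see `daFinal_fixed`.) -/
noncomputable def daFinal {n : ℕ} (P : Profile n) : Fin n → ℕ := daState P (n * n)

theorem daState_succ {n : ℕ} (P : Profile n) (r : ℕ) :
    daState P (r + 1) = daRound P (daState P r) :=
  Function.iterate_succ_apply' _ _ _

/-- A woman with a proposal still has one after the round. -/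
theorem exists_proposes_daRound {n : ℕ} (P : Profile n) (k : Fin n → ℕ) {m w : Fin n}
    (h : Proposes P k m w) : ∃ m', Proposes P (daRound P k) m' w := by
  classical
  obtain ⟨m', hm', hbest⟩ := Finset.exists_min_image
    (Finset.univ.filter fun x => Proposes P k x w) (fun x => (P.women w).symm x)
    ⟨m, by simpa using h⟩
  have hp : Proposes P k m' w := by simpa using hm'
  refine ⟨m', ?_⟩
  have hnr : ¬ IsRejected P k m' := by
    rintro ⟨w', m'', h1, h2, h3⟩
    have hw : w' = w := by
      apply (P.men m').symm.injective
      apply Fin.ext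
      unfold Proposes at h1 hp
      rw [h1, hp]
    subst hw
    have := hbest m'' (by simpa using h2)
    exact absurd h3 (not_lt.mpr this)
  unfold Proposes daRound
  rw [if_neg hnr]
  exact hp

/-- A woman who has rejected somebody has a proposal. -/
theorem exists_proposes_of_lt {n : ℕ} (P : Profile n) (r : ℕ) (m w : Fin n)
    (h : (((P.men m).symm w : Fin n) : ℕ) < daState P r m) :
    ∃ m', Proposes P (daState P r) m' w := by
  classical
  induction r generalizing m w with
  | zero => simp [daState] at h
  | succ r ih =>
    rw [daState_succ] at h ⊢
    by_cases h1 : (((P.men m).symm w : Fin n) : ℕ) < daState P r m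
    · obtain ⟨m', hm'⟩ := ih m w h1
      exact exists_proposes_daRound P _ hm'
    · have : Proposes P (daState P r) m w := by
        unfold daRound at h
        unfold Proposes
        split_ifs at h <;> omega
      exact exists_proposes_daRound P _ this

/-- No man is rejected by all the women. -/
theorem daState_lt {n : ℕ} (P : Profile n) (r : ℕ) (m : Fin n) : daState P r m < n := by
  by_contra hcon
  push Not at hcon
  have hex : ∀ w, ∃ m', Proposes P (daState P r) m' w := fun w =>
    exists_proposes_of_lt P r m w (lt_of_lt_of_le (Fin.is_lt _) hcon)
  choose f hf using hex
  have hinj : Function.Injective f := by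
    intro a b hab
    have ha := hf a
    have hb := hf b
    rw [← hab] at hb
    unfold Proposes at ha hb
    exact (P.men (f a)).symm.injective (Fin.ext (ha.trans hb.symm))
  obtain ⟨w, hw⟩ := (Finite.injective_iff_surjective.mp hinj) m
  have h := hf w
  rw [hw] at h
  unfold Proposes at h
  have := ((P.men m).symm w).is_lt
  omega

/-- The terminal state is terminal: nobody is rejected any more. -/
theorem daFinal_fixed {n : ℕ} (P : Profile n) : ∀ m, ¬ IsRejected P (daFinal P) m := by
  classical
  have key : ∀ r, (∀ m, ¬ IsRejected P (daState P r) m) ∨ r ≤ ∑ m, daState P r m := by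
    intro r
    induction r with
    | zero => right; exact Nat.zero_le _
    | succ r ih =>
      rw [daState_succ]
      by_cases hfix : ∀ m, ¬ IsRejected P (daState P r) m
      · left
        have : daRound P (daState P r) = daState P r := by
          funext m
          exact if_neg (hfix m)
        rwa [this]
      · right
        have hr := ih.resolve_left hfix
        push Not at hfix
        obtain ⟨m₀, h0⟩ := hfix
        have hlt : ∑ m, daState P r m < ∑ m, daRound P (daState P r) m := by
          apply Finset.sum_lt_sum
          · intro m _
            unfold daRound
            split_ifs <;> omega
          · refine ⟨m₀, Finset.mem_univ _, ?_⟩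
            unfold daRound
            rw [if_pos h0]
            omega
        omega
  rcases key (n * n) with h | h
  · exact h
  · intro m
    exfalso
    have hlt : ∑ i, daState P (n * n) i < ∑ _i : Fin n, n :=
      Finset.sum_lt_sum_of_nonempty ⟨m, Finset.mem_univ _⟩ (fun i _ => daState_lt P _ i)
    simp at hlt
    omega

/-- The woman to whom man `m` is engaged in the terminal state. -/
noncomputable def daPartner {n : ℕ} (P : Profile n) (m : Fin n) : Fin n :=
  P.men m ⟨daFinal P m, daState_lt P _ m⟩

theorem daPartner_bijective {n : ℕ} (P : Profile n) : Function.Bijective (daPartner P) := by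
  apply Finite.injective_iff_bijective.mp
  have hprop : ∀ m, Proposes P (daFinal P) m (daPartner P m) := by
    intro m
    simp [Proposes, daPartner]
  intro a b hab
  by_contra hne
  have ha := hprop a
  have hb := hprop b
  rw [← hab] at hb
  rcases lt_or_gt_of_ne (fun h => hne ((P.women (daPartner P a)).symm.injective h)) with h | h
  · exact daFinal_fixed P b ⟨_, a, hb, ha, h⟩
  · exact daFinal_fixed P a ⟨_, b, ha, hb, h⟩

/-- The matching computed by deferred acceptance: `DA P m` is the partner of man `m` and
`(DA P).symm w` is the partner of woman `w`. -/
noncomputable def DA {n : ℕ} (P : Profile n) : Fin n ≃ Fin n :=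
  Equiv.ofBijective (daPartner P) (daPartner_bijective P)

/-! ### One-for-all strategies of an accomplice -/

/-- The accomplice `m` does not incur regret by reporting `σ`. -/
def NoRegret {n : ℕ} (P : Profile n) (m : Fin n) (σ : PrefList n) : Prop :=
  (P.men m).WeakPrefers (DA (P.report m σ) m) (DA P m)

/-- All women weakly prefer the matching `μ` to the matching `ν`, by their lists in `P`. -/
def WomenWeakPrefer {n : ℕ} (P : Profile n) (μ ν : Fin n ≃ Fin n) : Prop :=
  ∀ w, (P.women w).WeakPrefers (μ.symm w) (ν.symm w)

/-- `σ` is an optimal one-for-all strategy of the accomplice `m`, among all the lists that he can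
report without incurring regret. -/
structure IsOptimalStrategy {n : ℕ} (P : Profile n) (m : Fin n) (σ : PrefList n) : Prop where
  noRegret : NoRegret P m σ
  improves : WomenWeakPrefer P (DA (P.report m σ)) (DA P)
  optimal : ∀ τ : PrefList n, NoRegret P m τ →
    WomenWeakPrefer P (DA (P.report m σ)) (DA (P.report m τ))

/-- The list `σ` arises from the true list of `m` by pushing up the set `X`: the women above
`DA P m` in `σ` are those above `DA P m` in the true list and those in `X` (other than `DA P m`
itself).  The order inside the part above and inside the part below `DA P m` is left open. -/
def IsPushUp {n : ℕ} (P : Profile n) (m : Fin n) (X : Set (Fin n)) (σ : PrefList n) : Prop :=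
  ∀ w, w ≠ DA P m → (σ.Prefers w (DA P m) ↔ ((P.men m).Prefers w (DA P m) ∨ w ∈ X))

/-- The no-regret set: the women whom `m` can push up individually without incurring regret. -/
def noRegretSet {n : ℕ} (P : Profile n) (m : Fin n) : Set (Fin n) :=
  {w | ∀ σ : PrefList n, IsPushUp P m {w} σ → NoRegret P m σ}

/-! ### Random access machine programs

Words are natural numbers of bounded size.  A program works on registers and on arrays of
words, both named by fixed numbers in the program text (so that a program uses finitely many of
them); an array cell is addressed by a computed word.  Every operation costs one step. -/

/-- Contents `reg x` of register `x` and contents `arr a i` of cell `i` of array `a`. -/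
structure State where
  reg : ℕ → ℕ
  arr : ℕ → ℕ → ℕ

/-- Operations on words; subtraction is truncated at `0`, comparisons return `1` or `0`. -/
inductive Op where
  | add | sub | mul | lt | eq

def Op.eval : Op → ℕ → ℕ → ℕ
  | .add, a, b => a + b
  | .sub, a, b => a - b
  | .mul, a, b => a * b
  | .lt, a, b => if a < b then 1 else 0
  | .eq, a, b => if a = b then 1 else 0

/-- Expressions: a literal, the contents of a register, the contents of the cell of a given array
at a computed address, or an operation. -/
inductive Expr where
  | lit (c : ℕ)
  | reg (x : ℕ)
  | read (a : ℕ) (i : Expr)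
  | bin (o : Op) (e f : Expr)

def Expr.eval (s : State) : Expr → ℕ
  | .lit c => c
  | .reg x => s.reg x
  | .read a i => s.arr a (i.eval s)
  | .bin o e f => o.eval (e.eval s) (f.eval s)

/-- The number of steps for evaluating an expression: one for every node. -/
def Expr.cost : Expr → ℕ
  | .lit _ => 1
  | .reg _ => 1
  | .read _ i => i.cost + 1
  | .bin _ e f => e.cost + f.cost + 1

/-- All values (and addresses) that occur in evaluating the expression are words, that is, at
most `B`. -/
def Expr.Fits (B : ℕ) (s : State) : Expr → Prop
  | .lit c => c ≤ B
  | .reg x => s.reg x ≤ B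
  | .read a i => i.Fits B s ∧ s.arr a (i.eval s) ≤ B
  | .bin o e f => e.Fits B s ∧ f.Fits B s ∧ o.eval (e.eval s) (f.eval s) ≤ B

/-- Programs. A test succeeds if its expression has a non-zero value. -/
inductive Prog where
  | skip
  | assign (x : ℕ) (e : Expr)
  | write (a : ℕ) (i e : Expr)
  | seq (p q : Prog)
  | cond (e : Expr) (p q : Prog)
  | loop (e : Expr) (p : Prog)

def State.setReg (s : State) (x v : ℕ) : State where
  reg := Function.update s.reg x v
  arr := s.arr

def State.setArr (s : State) (a i v : ℕ) : State where
  reg := s.reg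
  arr := Function.update s.arr a (Function.update (s.arr a) i v)

/-- `Exec B p s s' t`: on a machine whose words are the numbers up to `B`, the program `p`, started
in state `s`, halts in state `s'` after exactly `t` steps, without any overflow. -/
inductive Exec (B : ℕ) : Prog → State → State → ℕ → Prop where
  | skip (s : State) : Exec B .skip s s 1
  | assign (s : State) (x : ℕ) (e : Expr) (he : e.Fits B s) :
      Exec B (.assign x e) s (s.setReg x (e.eval s)) (e.cost + 1)
  | write (s : State) (a : ℕ) (i e : Expr) (hi : i.Fits B s) (he : e.Fits B s) :
      Exec B (.write a i e) s (s.setArr a (i.eval s) (e.eval s)) (i.cost + e.cost + 1)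
  | seq {p q : Prog} {s₁ s₂ s₃ : State} {t₁ t₂ : ℕ}
      (h₁ : Exec B p s₁ s₂ t₁) (h₂ : Exec B q s₂ s₃ t₂) :
      Exec B (.seq p q) s₁ s₃ (t₁ + t₂)
  | condTrue {e : Expr} {p q : Prog} {s s' : State} {t : ℕ} (hf : e.Fits B s)
      (he : e.eval s ≠ 0) (h : Exec B p s s' t) :
      Exec B (.cond e p q) s s' (e.cost + 1 + t)
  | condFalse {e : Expr} {p q : Prog} {s s' : State} {t : ℕ} (hf : e.Fits B s)
      (he : e.eval s = 0) (h : Exec B q s s' t) :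
      Exec B (.cond e p q) s s' (e.cost + 1 + t)
  | loopTrue {e : Expr} {p : Prog} {s₁ s₂ s₃ : State} {t₁ t₂ : ℕ} (hf : e.Fits B s₁)
      (he : e.eval s₁ ≠ 0) (h₁ : Exec B p s₁ s₂ t₁) (h₂ : Exec B (.loop e p) s₂ s₃ t₂) :
      Exec B (.loop e p) s₁ s₃ (e.cost + 1 + t₁ + t₂)
  | loopFalse {e : Expr} {p : Prog} {s : State} (hf : e.Fits B s) (he : e.eval s = 0) :
      Exec B (.loop e p) s s (e.cost + 1)

/-- Execution is deterministic: final state and number of steps are determined by the start. -/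
theorem Exec.deterministic {B : ℕ} {p : Prog} {s s₁ : State} {t₁ : ℕ} (h : Exec B p s s₁ t₁) :
    ∀ {s₂ : State} {t₂ : ℕ}, Exec B p s s₂ t₂ → s₁ = s₂ ∧ t₁ = t₂ := by
  induction h with
  | skip s => intro _ _ h'; cases h'; exact ⟨rfl, rfl⟩
  | assign s x e he => intro _ _ h'; cases h'; exact ⟨rfl, rfl⟩
  | write s a i e hi he => intro _ _ h'; cases h'; exact ⟨rfl, rfl⟩
  | seq _ _ ih₁ ih₂ =>
    intro _ _ h'
    cases h' with
    | seq k₁ k₂ =>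
      obtain ⟨rfl, rfl⟩ := ih₁ k₁
      obtain ⟨rfl, rfl⟩ := ih₂ k₂
      exact ⟨rfl, rfl⟩
  | condTrue hf he _ ih =>
    intro _ _ h'
    cases h' with
    | condTrue _ _ k => obtain ⟨rfl, rfl⟩ := ih k; exact ⟨rfl, rfl⟩
    | condFalse _ he' _ => exact absurd he' he
  | condFalse hf he _ ih =>
    intro _ _ h'
    cases h' with
    | condTrue _ he' _ => exact absurd he he'
    | condFalse _ _ k => obtain ⟨rfl, rfl⟩ := ih k; exact ⟨rfl, rfl⟩
  | loopTrue hf he _ _ ih₁ ih₂ =>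
    intro _ _ h'
    cases h' with
    | loopTrue _ _ k₁ k₂ =>
      obtain ⟨rfl, rfl⟩ := ih₁ k₁
      obtain ⟨rfl, rfl⟩ := ih₂ k₂
      exact ⟨rfl, rfl⟩
    | loopFalse _ he' => exact absurd he' he
  | loopFalse hf he =>
    intro _ _ h'
    cases h' with
    | loopTrue _ he' _ _ => exact absurd he he'
    | loopFalse _ _ => exact ⟨rfl, rfl⟩

/-! ### Input and output -/

/-- Preference lists as a table, row by row: cell `i * n + j` holds the label of the agent in
position `j` of the list of agent `i`; all cells from `n * n` on hold `0`. -/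
def table {n : ℕ} (T : Fin n → PrefList n) (i : ℕ) : ℕ :=
  if h : i < n * n then
    ((T (Fin.divNat (⟨i, h⟩ : Fin (n * n))) (Fin.modNat (⟨i, h⟩ : Fin (n * n))) : Fin n) : ℕ)
  else 0

/-- The input: register `0` holds `n`, register `1` the label of the accomplice, array `0` the
lists of the men, array `1` the lists of the women; everything else is `0`. -/
def inputState {n : ℕ} (P : Profile n) (m : Fin n) : State where
  reg x := if x = 0 then n else if x = 1 then (m : ℕ) else 0
  arr a i := if a = 0 then table P.men i else if a = 1 then table P.women i else 0

/-- Array `2` of the state holds the list `σ`. -/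
def OutputsList {n : ℕ} (s : State) (σ : PrefList n) : Prop :=
  ∀ k : Fin n, s.arr 2 k = ((σ k : Fin n) : ℕ)

/-- Array `3` of the state holds the indicator function of the set `X`. -/
def OutputsSet {n : ℕ} (s : State) (X : Set (Fin n)) : Prop :=
  ∀ w : Fin n, (w ∈ X → s.arr 3 w = 1) ∧ (w ∉ X → s.arr 3 w = 0)

end OneForAll

namespace OneForAll

variable {n : ℕ}

/-! ### Deferred acceptance: monotonicity and the standing proposals -/

/-! Suppose that `m` proposes to a set `X` of women, in no particular order, while the other men
follow their lists. The vectors of rejection numbers that leave no last proposal beaten are closed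
under pointwise minimum, so there is a least one, `leastCounts`. It grows with `X`, and it does not
involve the list of `m`. If `X` consists of the women to whom `m` has proposed when deferred
acceptance stops, it gives the final rejection numbers of the other men (`daFinal_eq_leastCounts`).
So the report of `m` matters to the others only through the set of women he proposes to.

The set `passSet` consists of the women who reject `m` when each is his only proposal; it is the
same for all reports. By `DA_notMem_passSet` and `mem_passSet_of_prefers_DA`, `m` always ends up
with the first woman of the reported list outside this set. Hence a report is without regret exactly
if all women above `DA P m` in it lie in `passSet` (`noRegret_iff`), and the no-regret set is
`passSet` together with `DA P m` (`noRegretSet_eq`). A report with exactly `passSet` above `DA P m`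
lets `m` propose to the largest possible set without changing his partner. By monotonicity the other
men then propose as far down their lists as possible, and each woman keeps the best proposal that
reaches her (`isPushUp_and_isOptimalStrategy`).

It remains to compute `passSet`. For one woman `w`, let `w` hold the proposal of `m` from the start
and run deferred acceptance sequentially for the others. A potential bounds the number of steps by a
multiple of `n * n` (`Config.done_iterate`), each step takes constant time with a table of ranks,
and at the end `w` has dropped `m` exactly if she is in `passSet` (`Config.Inv.hold_ne_iff`). Over
all `w` this takes cubic time; arranging the output list by a key costs only quadratic time. -/

theorem daState_le_succ (P : Profile n) (r : ℕ) (i : Fin n) :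
    daState P r i ≤ daState P (r + 1) i := by
  rw [daState_succ]
  unfold daRound
  split_ifs <;> omega

/-- The standing proposal that a woman holds does not get worse in a round. -/
theorem exists_proposes_daRound_le (P : Profile n) (k : Fin n → ℕ) {i w : Fin n}
    (h : Proposes P k i w) :
    ∃ i', Proposes P (daRound P k) i' w ∧ (P.women w).symm i' ≤ (P.women w).symm i := by
  classical
  obtain ⟨i', hi', hbest⟩ := Finset.exists_min_image
    (Finset.univ.filter fun x => Proposes P k x w) (fun x => (P.women w).symm x)
    ⟨i, by simpa using h⟩
  have hp : Proposes P k i' w := by simpa using hi'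
  refine ⟨i', ?_, hbest i (by simpa using h)⟩
  have hnr : ¬ IsRejected P k i' := by
    rintro ⟨w', j, h1, h2, h3⟩
    have hw : w' = w := (P.men i').symm.injective (Fin.ext (h1.trans hp.symm))
    subst hw
    exact absurd h3 (not_lt.mpr (hbest j (by simpa using h2)))
  unfold Proposes daRound
  rw [if_neg hnr]
  exact hp

/-- A woman who has received a proposal holds one that is at least as good. -/
theorem exists_proposes_le (P : Profile n) (r : ℕ) (i w : Fin n)
    (h : (((P.men i).symm w : Fin n) : ℕ) ≤ daState P r i) :
    ∃ i', Proposes P (daState P r) i' w ∧ (P.women w).symm i' ≤ (P.women w).symm i := by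
  induction r generalizing i w with
  | zero => exact ⟨i, by simpa [Proposes, daState] using h, le_rfl⟩
  | succ r ih =>
    by_cases h1 : (((P.men i).symm w : Fin n) : ℕ) ≤ daState P r i
    · obtain ⟨i', hp, hle⟩ := ih i w h1
      obtain ⟨j, hj, hle'⟩ := exists_proposes_daRound_le P _ hp
      exact ⟨j, by rwa [daState_succ], hle'.trans hle⟩
    · refine ⟨i, ?_, le_rfl⟩
      have : daState P (r + 1) i ≤ daState P r i + 1 := by
        rw [daState_succ]
        unfold daRound
        split_ifs <;> omega
      unfold Proposes
      omega

/-- In the terminal state no woman has ever had a proposal better than the standing one. -/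
theorem not_prefers_of_proposes_daFinal (P : Profile n) {i i' w : Fin n}
    (hi : Proposes P (daFinal P) i w)
    (hi' : (((P.men i').symm w : Fin n) : ℕ) ≤ daFinal P i') : ¬ (P.women w).Prefers i' i := by
  intro hpref
  obtain ⟨j, hj, hle⟩ := exists_proposes_le P (n * n) i' w hi'
  exact daFinal_fixed P i ⟨w, j, hi, hj, lt_of_le_of_lt hle hpref⟩

theorem proposes_DA (P : Profile n) (i : Fin n) : Proposes P (daFinal P) i (DA P i) := by
  simp [Proposes, DA, daPartner]

/-- A counter rises by at most one in a round, so no value is skipped: the round wanted is the one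
just before the counter first exceeds `p`. -/
theorem exists_daState_eq (P : Profile n) (i : Fin n) {p : ℕ} (hp : p < daFinal P i) :
    ∃ r, daState P r i = p ∧ IsRejected P (daState P r) i := by
  classical
  have hex : ∃ r, p < daState P r i := ⟨n * n, hp⟩
  have hspec := Nat.find_spec hex
  have hmin : ∀ r, r < Nat.find hex → ¬ p < daState P r i := fun r hr => Nat.find_min hex hr
  cases hr : Nat.find hex with
  | zero => rw [hr] at hspec; simp [daState] at hspec
  | succ r =>
    rw [hr] at hspec hmin
    have h1 := hmin r (Nat.lt_succ_self r)
    rw [daState_succ] at hspec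
    unfold daRound at hspec
    split_ifs at hspec with hrej
    · exact ⟨r, by omega, hrej⟩
    · exact absurd hspec h1

/-! ### Deferred acceptance with fixed proposals of one man -/

/-- Man `m` has proposed to the women in `X`, the other men `i` to the first `k i + 1` women of
their lists. -/
def HasProposed (P : Profile n) (m : Fin n) (X : Set (Fin n)) (k : Fin n → ℕ) (i w : Fin n) :
    Prop :=
  (i = m ∧ w ∈ X) ∨ (i ≠ m ∧ (((P.men i).symm w : Fin n) : ℕ) ≤ k i)

/-- Woman `w` has a proposal that is better than one by `i`. -/
def Beaten (P : Profile n) (m : Fin n) (X : Set (Fin n)) (k : Fin n → ℕ) (i w : Fin n) : Prop :=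
  ∃ i', HasProposed P m X k i' w ∧ (P.women w).Prefers i' i

/-- The last proposals of the men other than `m` are not rejected. -/
def ClosedCounts (P : Profile n) (m : Fin n) (X : Set (Fin n)) (k : Fin n → ℕ) : Prop :=
  ∀ i, i ≠ m → ∀ w, Proposes P k i w → ¬ Beaten P m X k i w

/-- The outcome of deferred acceptance of the men other than `m`, while `m` proposes to the women
in `X`: the least numbers of rejections that leave no proposal to be rejected. -/
noncomputable def leastCounts (P : Profile n) (m : Fin n) (X : Set (Fin n)) (i : Fin n) : ℕ :=
  sInf {a | ∃ k, ClosedCounts P m X k ∧ k i = a}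

theorem HasProposed.mono {P : Profile n} {m : Fin n} {X Y : Set (Fin n)} {k l : Fin n → ℕ}
    (hX : X ⊆ Y) (hk : ∀ i, i ≠ m → k i ≤ l i) {i w : Fin n} (h : HasProposed P m X k i w) :
    HasProposed P m Y l i w :=
  h.imp (fun h => ⟨h.1, hX h.2⟩) (fun h => ⟨h.1, h.2.trans (hk i h.1)⟩)

theorem Beaten.mono {P : Profile n} {m : Fin n} {X Y : Set (Fin n)} {k l : Fin n → ℕ}
    (hX : X ⊆ Y) (hk : ∀ i, i ≠ m → k i ≤ l i) {i w : Fin n} (h : Beaten P m X k i w) :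
    Beaten P m Y l i w := by
  obtain ⟨i', h1, h2⟩ := h
  exact ⟨i', h1.mono hX hk, h2⟩

theorem leastCounts_le {P : Profile n} {m : Fin n} {X : Set (Fin n)} {k : Fin n → ℕ}
    (hk : ClosedCounts P m X k) (i : Fin n) : leastCounts P m X i ≤ k i :=
  Nat.sInf_le ⟨k, hk, rfl⟩

/-- The infimum is attained because the set is nonempty: the constant vector `n` is closed, since no
position in a list equals `n` and so nobody has a last proposal. -/
theorem exists_leastCounts (P : Profile n) (m : Fin n) (X : Set (Fin n)) (i : Fin n) :
    ∃ k, ClosedCounts P m X k ∧ k i = leastCounts P m X i := by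
  refine Nat.sInf_mem (s := {a | ∃ k, ClosedCounts P m X k ∧ k i = a})
    ⟨n, fun _ => n, fun j _ w hw => ?_, rfl⟩
  exact absurd hw ((P.men j).symm w).is_lt.ne

/-- The infimum is taken separately for each man, so closedness needs an argument. A vector
attaining the minimum at `i` has the same last proposal of `i` and at least as many proposals by the
others, so whatever beats `i` in the minimum beats him there too. -/
theorem closedCounts_leastCounts (P : Profile n) (m : Fin n) (X : Set (Fin n)) :
    ClosedCounts P m X (leastCounts P m X) := by
  intro i hi w hw hb
  obtain ⟨k, hk, hki⟩ := exists_leastCounts P m X i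
  exact hk i hi w (hw.trans hki.symm) (hb.mono subset_rfl fun j _ => leastCounts_le hk j)

/-- Fewer proposals by `m` beat fewer men, so a vector closed for `Y` is closed for `X`. -/
theorem leastCounts_mono (P : Profile n) (m : Fin n) {X Y : Set (Fin n)} (h : X ⊆ Y)
    (i : Fin n) : leastCounts P m X i ≤ leastCounts P m Y i :=
  leastCounts_le (fun i hi w hw hb =>
    closedCounts_leastCounts P m Y i hi w hw (hb.mono h fun _ _ => le_rfl)) i

/-- All the proposals of the other men but the last ones are rejected. -/
theorem beaten_of_lt_leastCounts (P : Profile n) (m : Fin n) (X : Set (Fin n)) {i w : Fin n}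
    (hi : i ≠ m) (hw : (((P.men i).symm w : Fin n) : ℕ) < leastCounts P m X i) :
    Beaten P m X (leastCounts P m X) i w := by
  classical
  by_contra hb
  -- If `w` did not reject `i`, he could stop at her: the lowered vector would still be closed,
  -- against minimality.
  set l := Function.update (leastCounts P m X) i (((P.men i).symm w : Fin n) : ℕ) with hl
  have hle : ∀ j, j ≠ m → l j ≤ leastCounts P m X j := by
    intro j _
    rcases eq_or_ne j i with rfl | hj
    · simpa [hl] using hw.le
    · simp [hl, hj]
  have hcl : ClosedCounts P m X l := by
    intro j hj v hv hbj
    have hbj' := hbj.mono subset_rfl hle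
    rcases eq_or_ne j i with rfl | hji
    · have : v = w := by
        apply (P.men j).symm.injective
        apply Fin.ext
        simpa [Proposes, hl] using hv
      exact hb (this ▸ hbj')
    · exact closedCounts_leastCounts P m X j hj v (by simpa [Proposes, hl, hji] using hv) hbj'
  have := leastCounts_le hcl i
  simp only [hl, Function.update_self] at this
  omega

/-- If every woman has a proposal, then some woman prefers `m` to all other proposals. -/
theorem exists_not_beaten_of_forall_hasProposed (P : Profile n) (m : Fin n) (X : Set (Fin n))
    (h : ∀ w, ∃ i, HasProposed P m X (leastCounts P m X) i w) :
    ∃ w ∈ X, ¬ Beaten P m X (leastCounts P m X) m w := by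
  classical
  by_contra! hcon
  have hbest : ∀ w, ∃ i, HasProposed P m X (leastCounts P m X) i w ∧
      ¬ Beaten P m X (leastCounts P m X) i w := by
    intro w
    obtain ⟨i₀, hi₀⟩ := h w
    obtain ⟨i, hi, hmin⟩ := Finset.exists_min_image
      (Finset.univ.filter fun i => HasProposed P m X (leastCounts P m X) i w)
      (fun i => (P.women w).symm i) ⟨i₀, by simpa using hi₀⟩
    refine ⟨i, by simpa using hi, ?_⟩
    rintro ⟨j, hj, hpref⟩
    exact absurd hpref (not_lt.mpr (hmin j (by simpa using hj)))
  choose f hf hnb using hbest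
  -- No woman has `m` as her best proposer, and each best proposer is at his last proposal. This
  -- gives an injection of the women into the men that misses `m`, which is impossible.
  have hfm : ∀ w, f w ≠ m := by
    intro w hw
    rcases hf w with ⟨-, hX⟩ | ⟨hne, -⟩
    · exact hnb w (hw ▸ hcon w hX)
    · exact hne hw
  have hlast : ∀ w, (((P.men (f w)).symm w : Fin n) : ℕ) = leastCounts P m X (f w) := by
    intro w
    rcases hf w with ⟨he, -⟩ | ⟨hne, hle⟩
    · exact absurd he (hfm w)
    · refine hle.antisymm (not_lt.mp fun hlt => hnb w (beaten_of_lt_leastCounts P m X hne hlt))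
  have hinj : Function.Injective f := by
    intro a b hab
    have ha := hlast a
    have hb := hlast b
    rw [← hab] at hb
    exact (P.men (f a)).symm.injective (Fin.ext (ha.trans hb.symm))
  obtain ⟨w, hw⟩ := Finite.injective_iff_surjective.mp hinj m
  exact hfm w hw

/-- As long as `m` has not proposed outside `Y`, the others are not rejected more often than when
`m` proposes to all of `Y`. -/
theorem daState_le_leastCounts (P : Profile n) (m : Fin n) (Y : Set (Fin n)) (r : ℕ)
    (hY : ∀ w, (((P.men m).symm w : Fin n) : ℕ) ≤ daState P r m → w ∈ Y) (i : Fin n)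
    (hi : i ≠ m) : daState P r i ≤ leastCounts P m Y i := by
  induction r generalizing i with
  | zero => exact Nat.zero_le _
  | succ r ih =>
    have hY' : ∀ w, (((P.men m).symm w : Fin n) : ℕ) ≤ daState P r m → w ∈ Y :=
      fun w hw => hY w (hw.trans (daState_le_succ P r m))
    have ih' := ih hY'
    rw [daState_succ]
    unfold daRound
    split_ifs with hrej
    -- Were `i` rejected with his counter already at the bound, his last proposal in the least
    -- closed outcome would be beaten.
    · refine Nat.succ_le_of_lt (lt_of_le_of_ne (ih' i hi) fun heq => ?_)
      obtain ⟨w, j, h1, h2, h3⟩ := hrej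
      refine closedCounts_leastCounts P m Y i hi w (h1.trans heq) ⟨j, ?_, h3⟩
      rcases eq_or_ne j m with rfl | hj
      · exact Or.inl ⟨rfl, hY' w h2.le⟩
      · exact Or.inr ⟨hj, h2.le.trans (ih' j hj)⟩
    · exact ih' i hi

/-- The terminal state is itself closed for the set of women to whom `m` has proposed. -/
theorem leastCounts_le_daFinal (P : Profile n) (m : Fin n) (i : Fin n) :
    leastCounts P m {w | (((P.men m).symm w : Fin n) : ℕ) ≤ daFinal P m} i ≤ daFinal P i := by
  apply leastCounts_le
  rintro j hj w hw ⟨i', h1, h2⟩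
  refine not_prefers_of_proposes_daFinal P hw ?_ h2
  rcases h1 with ⟨rfl, h⟩ | ⟨-, h⟩ <;> exact h

/-- The man `m` is excluded because closedness does not constrain his entry, whose least value is
`0`. -/
theorem daFinal_eq_leastCounts (P : Profile n) (m : Fin n) (i : Fin n) (hi : i ≠ m) :
    daFinal P i = leastCounts P m {w | (((P.men m).symm w : Fin n) : ℕ) ≤ daFinal P m} i :=
  (daState_le_leastCounts P m _ (n * n) (fun _ h => h) i hi).antisymm
    (leastCounts_le_daFinal P m i)

/-- The women who reject `m` when he proposes to them first. -/
def passSet (P : Profile n) (m : Fin n) : Set (Fin n) :=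
  {w | Beaten P m {w} (leastCounts P m {w}) m w}

/-- A proposal that beats `m` when he proposes to his partner only is also made when he proposes to
more women, hence in the terminal state, where his partner would then have rejected him. -/
theorem DA_notMem_passSet (P : Profile n) (m : Fin n) : DA P m ∉ passSet P m := by
  intro h
  have hsub : ({DA P m} : Set (Fin n)) ⊆
      {w | (((P.men m).symm w : Fin n) : ℕ) ≤ daFinal P m} := by
    rintro _ rfl
    exact (proposes_DA P m).le
  obtain ⟨i, h1, h2⟩ := h.mono (l := daFinal P) hsub fun i _ =>
    (leastCounts_mono P m hsub i).trans (leastCounts_le_daFinal P m i)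
  refine not_prefers_of_proposes_daFinal P (proposes_DA P m) ?_ h2
  rcases h1 with ⟨rfl, h⟩ | ⟨-, h⟩ <;> exact h

/-! ### Independence of the report of `m` -/

theorem report_women (P : Profile n) (m : Fin n) (σ : PrefList n) :
    (P.report m σ).women = P.women := rfl

theorem report_men_self (P : Profile n) (m : Fin n) (σ : PrefList n) :
    (P.report m σ).men m = σ := by simp [Profile.report]

theorem report_men_of_ne (P : Profile n) {m i : Fin n} (σ : PrefList n) (hi : i ≠ m) :
    (P.report m σ).men i = P.men i := by simp [Profile.report, hi]

theorem report_self (P : Profile n) (m : Fin n) : P.report m (P.men m) = P := by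
  cases P
  simp [Profile.report]

theorem hasProposed_report (P : Profile n) (m : Fin n) (σ : PrefList n) :
    HasProposed (P.report m σ) m = HasProposed P m := by
  funext X k i w
  unfold HasProposed
  rcases eq_or_ne i m with rfl | hi
  · simp
  · simp [hi, report_men_of_ne]

theorem beaten_report (P : Profile n) (m : Fin n) (σ : PrefList n) :
    Beaten (P.report m σ) m = Beaten P m := by
  funext X k i w
  unfold Beaten
  rw [hasProposed_report, report_women]

theorem leastCounts_report (P : Profile n) (m : Fin n) (σ : PrefList n) :
    leastCounts (P.report m σ) m = leastCounts P m := by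
  have h : ClosedCounts (P.report m σ) m = ClosedCounts P m := by
    funext X k
    unfold ClosedCounts
    rw [beaten_report]
    refine propext (forall_congr' fun i => forall_congr' fun hi => ?_)
    simp only [Proposes, report_men_of_ne P σ hi]
  unfold leastCounts
  rw [h]

theorem passSet_report (P : Profile n) (m : Fin n) (σ : PrefList n) :
    passSet (P.report m σ) m = passSet P m := by
  unfold passSet
  rw [beaten_report, leastCounts_report]

/-- If `m` is accepted by the woman he proposes to first, every woman has a proposal. -/
theorem exists_hasProposed_of_notMem_passSet (P : Profile n) (m : Fin n) {y : Fin n}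
    (hy : y ∉ passSet P m) (w : Fin n) :
    ∃ i, HasProposed P m {y} (leastCounts P m {y}) i w := by
  have hn : 0 < n := m.pos
  -- A report with `y` on top: `m` is never rejected, so deferred acceptance matches all women while
  -- `m` proposes to `y` alone.
  set τ : PrefList n := Equiv.swap ⟨0, hn⟩ y with hτ
  have hτy : ∀ v, ((τ.symm v : Fin n) : ℕ) ≤ 0 → v ∈ ({y} : Set (Fin n)) := by
    intro v hv
    have h0 : τ.symm v = ⟨0, hn⟩ := Fin.ext (by simpa using hv)
    rw [Equiv.symm_apply_eq] at h0
    simpa [hτ] using h0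
  set Q := P.report m τ with hQ
  have hQm : Q.men m = τ := report_men_self P m τ
  have hzero : ∀ r, daState Q r m = 0 := by
    intro r
    induction r with
    | zero => rfl
    | succ r ih =>
      rw [daState_succ]
      unfold daRound
      split_ifs with hrej
      · exfalso
        have hle := daState_le_leastCounts Q m {y} r (by rw [ih, hQm]; exact hτy)
        obtain ⟨v, j, h1, h2, h3⟩ := hrej
        have hv : v = y := hτy v (by rw [← hQm]; exact (h1.trans ih).le)
        subst hv
        have : v ∈ passSet Q m := by
          refine ⟨j, ?_, h3⟩
          rcases eq_or_ne j m with rfl | hj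
          · exact Or.inl ⟨rfl, rfl⟩
          · exact Or.inr ⟨hj, h2.le.trans (hle j hj)⟩
        rw [hQ, passSet_report] at this
        exact hy this
      · exact ih
  have hle := daState_le_leastCounts Q m {y} (n * n) (by rw [hzero, hQm]; exact hτy)
  obtain ⟨i, rfl⟩ := (DA Q).surjective w
  have hp := proposes_DA Q i
  refine ⟨i, ?_⟩
  rw [← leastCounts_report P m τ, ← hasProposed_report P m τ]
  rcases eq_or_ne i m with rfl | hi
  · refine Or.inl ⟨rfl, hτy _ ?_⟩
    rw [← hQm]
    exact (hp.trans (hzero (n * n))).le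
  · exact Or.inr ⟨hi, hp.le.trans (hle i hi)⟩

/-- Let `X` be the women above the partner of `m`. If some `y` in `X` accepted `m` as her first
suitor, every woman would have a proposal in the outcome for `y` alone, hence in that for `X`. By
counting, some woman in `X` would then prefer `m` to all her proposals. But she did reject `m` in
the actual run, in favour of a proposal that is also present in the outcome for `X`. -/
theorem mem_passSet_of_prefers_DA (P : Profile n) (m : Fin n) {y : Fin n}
    (h : (P.men m).Prefers y (DA P m)) : y ∈ passSet P m := by
  by_contra hy
  set X : Set (Fin n) := {w | (P.men m).Prefers w (DA P m)} with hX
  have hXlt : ∀ w, w ∈ X ↔ (((P.men m).symm w : Fin n) : ℕ) < daFinal P m := by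
    intro w
    have : (((P.men m).symm (DA P m) : Fin n) : ℕ) = daFinal P m := proposes_DA P m
    rw [← this]
    exact Iff.rfl
  have hyX : ({y} : Set (Fin n)) ⊆ X := by
    rintro _ rfl
    exact h
  obtain ⟨x, hx, hnb⟩ := exists_not_beaten_of_forall_hasProposed P m X fun w => by
    obtain ⟨i, hi⟩ := exists_hasProposed_of_notMem_passSet P m hy w
    exact ⟨i, hi.mono hyX fun j _ => leastCounts_mono P m hyX j⟩
  obtain ⟨r, hr, v, j, h1, h2, h3⟩ := exists_daState_eq P m ((hXlt x).1 hx)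
  have hv : v = x := (P.men m).symm.injective (Fin.ext (h1.trans hr))
  subst hv
  refine hnb ⟨j, ?_, h3⟩
  rcases eq_or_ne j m with rfl | hj
  · exact Or.inl ⟨rfl, hx⟩
  -- In round `r` the man `m` has reached only `v` and women above her, so he has not yet left `X`.
  · refine Or.inr ⟨hj, h2.le.trans (daState_le_leastCounts P m X r (fun w hw => ?_) j hj)⟩
    have := (hXlt v).1 hx
    exact (hXlt w).2 (by omega)

/-! ### No-regret strategies and the optimal strategy -/

/-- No report gains anything for `m`: a woman he truly prefers to his partner is in `passSet`, but
his partner under any report is not, and `passSet` is the same for all reports. -/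
theorem noRegret_iff_DA_eq (P : Profile n) (m : Fin n) (σ : PrefList n) :
    NoRegret P m σ ↔ DA (P.report m σ) m = DA P m := by
  refine ⟨fun h => h.resolve_left fun hp => ?_, Or.inr⟩
  have := DA_notMem_passSet (P.report m σ) m
  rw [passSet_report] at this
  exact this (mem_passSet_of_prefers_DA P m hp)

/-- The partner of `m` under `σ` is the first woman of `σ` outside `passSet`, and `DA P m` lies
outside. -/
theorem noRegret_iff (P : Profile n) (m : Fin n) (σ : PrefList n) :
    NoRegret P m σ ↔ ∀ w, σ.Prefers w (DA P m) → w ∈ passSet P m := by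
  rw [noRegret_iff_DA_eq]
  have h1 := DA_notMem_passSet (P.report m σ) m
  have h2 := fun y => mem_passSet_of_prefers_DA (P.report m σ) m (y := y)
  rw [passSet_report] at h1 h2
  rw [report_men_self] at h2
  constructor
  · intro h w hw
    exact h2 w (h ▸ hw)
  · intro h
    rcases lt_trichotomy (σ.symm (DA (P.report m σ) m)) (σ.symm (DA P m)) with hlt | heq | hlt
    · exact absurd (h _ hlt) h1
    · exact σ.symm.injective heq
    · exact absurd (h2 _ hlt) (DA_notMem_passSet P m)

/-- A list with a prescribed set of agents above a given one. -/
theorem exists_prefList (X : Set (Fin n)) (a : Fin n) :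
    ∃ σ : PrefList n, ∀ w, w ≠ a → (σ.Prefers w a ↔ w ∈ X) := by
  classical
  let f : Fin n → ℕ := fun w => if w = a then 1 else if w ∈ X then 0 else 2
  have hmono := Tuple.monotone_sort f
  have hlt : ∀ u v, f u < f v → (Tuple.sort f).symm u < (Tuple.sort f).symm v := by
    intro u v huv
    by_contra! hle
    have := hmono hle
    simp only [Function.comp_apply, Equiv.apply_symm_apply] at this
    omega
  refine ⟨Tuple.sort f, fun w hw => ?_⟩
  by_cases hX : w ∈ X
  · simp only [hX, iff_true]
    exact hlt w a (by simp [f, hw, hX])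
  · simp only [hX, iff_false]
    exact not_lt.2 (hlt a w (by simp [f, hw, hX])).le

/-- Pushing up one woman keeps all women truly above `DA P m`, who are in `passSet` anyway, so only
the new one decides. `DA P m` has to be inserted because pushing her up changes nothing. -/
theorem noRegretSet_eq (P : Profile n) (m : Fin n) :
    noRegretSet P m = insert (DA P m) (passSet P m) := by
  ext w
  rw [Set.mem_insert_iff]
  constructor
  · intro hw
    by_cases hwa : w = DA P m
    · exact Or.inl hwa
    · obtain ⟨σ, hσ⟩ := exists_prefList {v | (P.men m).Prefers v (DA P m) ∨ v = w} (DA P m)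
      have := (noRegret_iff P m σ).1 (hw σ hσ) w
      exact Or.inr (this ((hσ w hwa).2 (Or.inr rfl)))
  · intro hw σ hσ
    rw [noRegret_iff]
    intro v hv
    have hne : v ≠ DA P m := by
      rintro rfl
      exact lt_irrefl _ hv
    rcases (hσ v hne).1 hv with h | h
    · exact mem_passSet_of_prefers_DA P m h
    · rcases hw with rfl | hw
      · exact absurd h hne
      · exact (h : v = w) ▸ hw

/-- Pushing up the women who reject `m` is an optimal strategy. -/
theorem isPushUp_and_isOptimalStrategy (P : Profile n) (m : Fin n) (σ : PrefList n)
    (hσ : ∀ w, σ.Prefers w (DA P m) ↔ w ∈ passSet P m) :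
    IsPushUp P m (noRegretSet P m) σ ∧ IsOptimalStrategy P m σ := by
  have hnr : NoRegret P m σ := (noRegret_iff P m σ).2 fun w hw => (hσ w).1 hw
  have hopt : ∀ τ : PrefList n, NoRegret P m τ →
      WomenWeakPrefer P (DA (P.report m σ)) (DA (P.report m τ)) := by
    intro τ hτ w
    have eσ := (noRegret_iff_DA_eq P m σ).1 hnr
    have eτ := (noRegret_iff_DA_eq P m τ).1 hτ
    obtain ⟨i, rfl⟩ := (DA (P.report m τ)).surjective w
    rw [Equiv.symm_apply_apply]
    rcases eq_or_ne i m with rfl | hi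
    · right
      rw [Equiv.symm_apply_eq, eσ, eτ]
    · set Qσ := P.report m σ
      set Qτ := P.report m τ
      -- Under both reports `m` stops at `DA P m`. Above her `τ` has only women in `passSet`, while
      -- `σ` has all of them.
      have hsub : {w | (((Qτ.men m).symm w : Fin n) : ℕ) ≤ daFinal Qτ m} ⊆
          {w | (((Qσ.men m).symm w : Fin n) : ℕ) ≤ daFinal Qσ m} := by
        have p1 : (((Qσ.men m).symm (DA Qσ m) : Fin n) : ℕ) = daFinal Qσ m := proposes_DA Qσ m
        have p2 : (((Qτ.men m).symm (DA Qτ m) : Fin n) : ℕ) = daFinal Qτ m := proposes_DA Qτ m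
        intro v hv
        rw [Set.mem_ofPred_eq, ← p2, eτ, report_men_self] at hv
        rw [Set.mem_ofPred_eq, ← p1, eσ, report_men_self]
        rcases hv.lt_or_eq with hlt | heq
        · have h : σ.symm v < σ.symm (DA P m) := (hσ v).2 ((noRegret_iff P m τ).1 hτ v hlt)
          exact h.le
        · rw [τ.symm.injective (Fin.ext heq)]
      have hle : daFinal Qτ i ≤ daFinal Qσ i := by
        rw [daFinal_eq_leastCounts Qτ m i hi, daFinal_eq_leastCounts Qσ m i hi,
          leastCounts_report, leastCounts_report]
        exact leastCounts_mono P m hsub i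
      set w := DA Qτ i with hw
      obtain ⟨j, hj⟩ := (DA Qσ).surjective w
      have hjw : Proposes Qσ (daFinal Qσ) j w := hj ▸ proposes_DA Qσ j
      -- Being rejected at least as often under `σ`, man `i` has proposed to `w` there too, so her
      -- final partner is no worse than `i`.
      have hiw : (((Qσ.men i).symm w : Fin n) : ℕ) ≤ daFinal Qσ i := by
        have h : (((Qτ.men i).symm w : Fin n) : ℕ) = daFinal Qτ i := proposes_DA Qτ i
        rw [report_men_of_ne P τ hi] at h
        rw [report_men_of_ne P σ hi]
        omega
      have hnp := not_prefers_of_proposes_daFinal Qσ hjw hiw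
      rw [← hj, Equiv.symm_apply_apply]
      rcases (not_lt.1 hnp).lt_or_eq with hlt | heq
      · left
        rw [hj]
        exact hlt
      · exact Or.inr ((P.women w).symm.injective heq)
  refine ⟨fun w hw => ?_, hnr, ?_, hopt⟩
  · rw [hσ, noRegretSet_eq, Set.mem_insert_iff]
    constructor
    · exact fun h => Or.inr (Or.inr h)
    · rintro (h | h | h)
      · exact mem_passSet_of_prefers_DA P m h
      · exact absurd h hw
      · exact h
  -- The truthful list is one of the competing strategies without regret.
  · have := hopt (P.men m) (Or.inr (by rw [report_self]))
    rwa [report_self] at this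

/-! ### Reasoning about programs -/

theorem ite_one_zero_le (p : Prop) [Decidable p] : (if p then 1 else 0) ≤ 1 := by
  split_ifs <;> omega

/-- On words up to `B`, the program `p` started in `s` halts within `T` steps, without overflow,
in a state that satisfies `Q`. -/
def RunsIn (B : ℕ) (p : Prog) (s : State) (T : ℕ) (Q : State → Prop) : Prop :=
  ∃ s' t, Exec B p s s' t ∧ t ≤ T ∧ Q s'

namespace RunsIn

variable {B T : ℕ} {s : State} {p q : Prog} {Q : State → Prop}

theorem mono {T' : ℕ} {Q' : State → Prop} (h : RunsIn B p s T Q) (hT : T ≤ T')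
    (hQ : ∀ s', Q s' → Q' s') : RunsIn B p s T' Q' := by
  obtain ⟨s', t, h1, h2, h3⟩ := h
  exact ⟨s', t, h1, h2.trans hT, hQ _ h3⟩

theorem skip (hT : 1 ≤ T) (hQ : Q s) : RunsIn B .skip s T Q :=
  ⟨s, 1, .skip s, hT, hQ⟩

theorem assign {x : ℕ} {e : Expr} (he : e.Fits B s) (hT : e.cost + 1 ≤ T)
    (hQ : Q (s.setReg x (e.eval s))) : RunsIn B (.assign x e) s T Q :=
  ⟨_, _, .assign s x e he, hT, hQ⟩

theorem write {a : ℕ} {i e : Expr} (hi : i.Fits B s) (he : e.Fits B s)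
    (hT : i.cost + e.cost + 1 ≤ T) (hQ : Q (s.setArr a (i.eval s) (e.eval s))) :
    RunsIn B (.write a i e) s T Q :=
  ⟨_, _, .write s a i e hi he, hT, hQ⟩

theorem seq (T₁ T₂ : ℕ) (hT : T₁ + T₂ ≤ T)
    (h : RunsIn B p s T₁ fun s' => RunsIn B q s' T₂ Q) : RunsIn B (.seq p q) s T Q := by
  obtain ⟨s₁, t₁, h1, h2, s₂, t₂, h3, h4, h5⟩ := h
  exact ⟨s₂, t₁ + t₂, .seq h1 h3, by omega, h5⟩

theorem assign_seq {x : ℕ} {e : Expr} (he : e.Fits B s) (hT : e.cost + 1 ≤ T)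
    (h : RunsIn B q (s.setReg x (e.eval s)) (T - (e.cost + 1)) Q) :
    RunsIn B (.seq (.assign x e) q) s T Q :=
  seq (e.cost + 1) (T - (e.cost + 1)) (by omega) (assign he le_rfl h)

theorem write_seq {a : ℕ} {i e : Expr} (hi : i.Fits B s) (he : e.Fits B s)
    (hT : i.cost + e.cost + 1 ≤ T)
    (h : RunsIn B q (s.setArr a (i.eval s) (e.eval s)) (T - (i.cost + e.cost + 1)) Q) :
    RunsIn B (.seq (.write a i e) q) s T Q :=
  seq (i.cost + e.cost + 1) (T - (i.cost + e.cost + 1)) (by omega) (write hi he le_rfl h)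

theorem cond {e : Expr} (he : e.Fits B s) (hT : e.cost + 1 ≤ T)
    (h₁ : e.eval s ≠ 0 → RunsIn B p s (T - (e.cost + 1)) Q)
    (h₂ : e.eval s = 0 → RunsIn B q s (T - (e.cost + 1)) Q) :
    RunsIn B (.cond e p q) s T Q := by
  by_cases h : e.eval s = 0
  · obtain ⟨s', t, k1, k2, k3⟩ := h₂ h
    exact ⟨s', _, .condFalse he h k1, by omega, k3⟩
  · obtain ⟨s', t, k1, k2, k3⟩ := h₁ h
    exact ⟨s', _, .condTrue he h k1, by omega, k3⟩

end RunsIn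

/-- Run `p` with the values `0, 1, ...` below that of `e` in register `x`. -/
def Prog.forLoop (x : ℕ) (e : Expr) (p : Prog) : Prog :=
  .seq (.assign x (.lit 0))
    (.loop (.bin .lt (.reg x) e) (.seq p (.assign x (.bin .add (.reg x) (.lit 1)))))

/-- Each pass costs the body, `e.cost + 3` for the test and `4` for the increment; the failing last
test adds `e.cost + 3` and the initial assignment `2`. The bound on `N + 1` leaves room for the
counter and for the value `1` of a comparison. The expression `e` is evaluated again at every test,
so the invariant has to preserve its value. -/
theorem RunsIn.forLoop {B T N x : ℕ} {e : Expr} {p : Prog} {s : State} (I : ℕ → State → Prop)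
    (hB : N + 1 ≤ B) (hstart : I 0 (s.setReg x 0))
    (hI : ∀ k s, I k s → s.reg x = k ∧ e.Fits B s ∧ e.eval s = N)
    (hbody : ∀ k s, k < N → I k s →
      RunsIn B p s T fun s' => s'.reg x = k ∧ I (k + 1) (s'.setReg x (k + 1))) :
    RunsIn B (.forLoop x e p) s (N * (T + e.cost + 7) + e.cost + 5) (I N) := by
  have key : ∀ d k s, k + d = N → I k s →
      RunsIn B (.loop (.bin .lt (.reg x) e)
        (.seq p (.assign x (.bin .add (.reg x) (.lit 1))))) s
        (d * (T + e.cost + 7) + e.cost + 3) (I N) := by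
    intro d
    induction d with
    | zero =>
      intro k s hk hs
      obtain ⟨h1, h2, h3⟩ := hI k s hs
      obtain rfl : k = N := hk
      refine ⟨s, _, .loopFalse ?_ ?_, ?_, hs⟩
      · simp only [Expr.Fits, Expr.eval, Op.eval]
        exact ⟨by omega, h2, (ite_one_zero_le _).trans (by omega)⟩
      · simp [Expr.eval, Op.eval, h1, h3]
      · simp only [Expr.cost]
        omega
    | succ d ih =>
      intro k s hk hs
      obtain ⟨h1, h2, h3⟩ := hI k s hs
      obtain ⟨s₁, t₁, k1, k2, k3, k4⟩ := hbody k s (by omega) hs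
      obtain ⟨s₂, t₂, l1, l2, l3⟩ := ih (k + 1) _ (by omega) k4
      have hinc : Exec B (.assign x (.bin .add (.reg x) (.lit 1))) s₁ (s₁.setReg x (k + 1)) 4 := by
        rw [← k3]
        refine .assign s₁ x (.bin .add (.reg x) (.lit 1)) ?_
        simp only [Expr.Fits, Expr.eval, Op.eval]
        omega
      refine ⟨s₂, _, .loopTrue ?_ ?_ (.seq k1 hinc) l1, ?_, l3⟩
      · simp only [Expr.Fits, Expr.eval, Op.eval]
        exact ⟨by omega, h2, (ite_one_zero_le _).trans (by omega)⟩
      · simp only [Expr.eval, Op.eval, h1, h3]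
        rw [if_pos (by omega)]
        exact one_ne_zero
      · simp only [Expr.cost]
        have : (d + 1) * (T + e.cost + 7) = d * (T + e.cost + 7) + (T + e.cost + 7) := by ring
        omega
  refine RunsIn.seq 2 (N * (T + e.cost + 7) + e.cost + 3) (by omega) ?_
  refine RunsIn.assign ?_ (by simp [Expr.cost]) ?_
  · simp [Expr.Fits]
  · exact key N 0 _ (by omega) hstart

/-! ### Sequential deferred acceptance with one proposal of `m`

The men are `0, ..., n - 1`, and `n` is a dummy man, whom all women like least. -/

/-- The position of man `j` in the list `l`, the dummy man being last. -/
def rankOf (l : PrefList n) (j : ℕ) : ℕ := if h : j < n then ((l.symm ⟨j, h⟩ : Fin n) : ℕ) else n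

theorem rankOf_coe (l : PrefList n) (j : Fin n) : rankOf l j = ((l.symm j : Fin n) : ℕ) := by
  simp [rankOf]

theorem rankOf_le (l : PrefList n) (j : ℕ) : rankOf l j ≤ n := by
  unfold rankOf
  split_ifs <;> omega

/-- `ptr j` is the number of rejections of man `j`, `hold x` the man whose proposal woman `x`
holds, `cand` the man to propose next and `next` the first man who has not been considered yet. -/
structure Config (n : ℕ) where
  ptr : ℕ → ℕ
  hold : Fin n → ℕ
  cand : ℕ
  next : ℕ

namespace Config

/-- Woman `w` holds the proposal of `m`; neither `m` nor the dummy man can propose. -/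
def start (m w : Fin n) : Config n where
  ptr j := if j = n ∨ j = m then n else 0
  hold x := if x = w then m else n
  cand := n
  next := 0

/-- The candidate makes a proposal, or is replaced by the next man. -/
def step (P : Profile n) (g : Config n) : Config n :=
  if h : g.cand < n ∧ g.ptr g.cand < n then
    let x := P.men ⟨g.cand, h.1⟩ ⟨g.ptr g.cand, h.2⟩
    if rankOf (P.women x) g.cand < rankOf (P.women x) (g.hold x) then
      { g with
        ptr := Function.update g.ptr (g.hold x) (g.ptr (g.hold x) + 1)
        hold := Function.update g.hold x g.cand
        cand := g.hold x }
    else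
      { g with ptr := Function.update g.ptr g.cand (g.ptr g.cand + 1) }
  else if g.next < n then { g with cand := g.next, next := g.next + 1 }
  else g

/-- The field `sound` keeps the pointers below the least closed outcome; `improve`, `improve_self`
and `engaged` make them closed once the run is over, so that the two coincide. The pointers of `m`
and of the dummy man only have to be at least `n`, which keeps these two from proposing; their exact
values mean nothing. -/
structure Inv (P : Profile n) (m w : Fin n) (g : Config n) : Prop where
  cand_le : g.cand ≤ n
  next_le : g.next ≤ n
  hold_le : ∀ x, g.hold x ≤ n
  ptr_self : n ≤ g.ptr m
  ptr_dummy : n ≤ g.ptr n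
  ptr_le : ∀ j : Fin n, j ≠ m → g.ptr j ≤ n
  hold_ptr : ∀ x, ∀ j : Fin n, j ≠ m → g.hold x = j →
    (((P.men j).symm x : Fin n) : ℕ) = g.ptr j ∧ g.cand ≠ j ∧ (j : ℕ) < g.next
  hold_self : ∀ x, g.hold x = m → x = w
  fresh : ∀ j : Fin n, j ≠ m → g.next ≤ j → g.ptr j = 0 ∧ g.cand ≠ j
  engaged : ∀ j : Fin n, j ≠ m → (j : ℕ) < g.next → g.cand ≠ j → g.ptr j < n →
    ∃ x, g.hold x = j
  sound : ∀ j : Fin n, j ≠ m → g.ptr j ≤ leastCounts P m {w} j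
  improve : ∀ j : Fin n, j ≠ m → ∀ x, (((P.men j).symm x : Fin n) : ℕ) < g.ptr j →
    rankOf (P.women x) (g.hold x) < rankOf (P.women x) j
  improve_self : rankOf (P.women w) (g.hold w) ≤ rankOf (P.women w) m

def Done (g : Config n) : Prop := n ≤ g.next ∧ n ≤ g.ptr g.cand

theorem inv_start (P : Profile n) (m w : Fin n) : (start m w).Inv P m w where
  cand_le := le_rfl
  next_le := Nat.zero_le _
  hold_le x := by
    simp only [start]
    split_ifs <;> omega
  ptr_self := by simp [start]
  ptr_dummy := by simp [start]
  ptr_le j hj := by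
    simp only [start]
    split_ifs <;> omega
  hold_ptr x j hj h := by
    simp only [start] at h
    split_ifs at h
    · exact absurd (Fin.ext h.symm) hj
    · omega
  hold_self x h := by
    simp only [start] at h
    split_ifs at h
    · assumption
    · omega
  fresh j hj _ := by
    have := Fin.val_ne_of_ne hj
    simp only [start]
    rw [if_neg (by omega)]
    omega
  engaged j _ h := absurd h (Nat.not_lt_zero _)
  sound j hj := by
    have := Fin.val_ne_of_ne hj
    simp only [start]
    rw [if_neg (by omega)]
    exact Nat.zero_le _
  improve j hj x h := by
    have := Fin.val_ne_of_ne hj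
    simp only [start] at h
    rw [if_neg (by omega)] at h
    omega
  improve_self := by simp [start]

/-! ### Correctness and termination of the sequential run -/

section

variable {P : Profile n} {m w : Fin n} {g : Config n}

theorem rankOf_inj (l : PrefList n) {a b : Fin n} (h : rankOf l a = rankOf l b) : a = b := by
  rw [rankOf_coe, rankOf_coe] at h
  exact l.symm.injective (Fin.ext h)

/-- A man who loses against a proposal does so in the least closed outcome too. -/
theorem Inv.lt_leastCounts (hg : g.Inv P m w) {x j : Fin n} {h : ℕ} (hj : j ≠ m)
    (hx : (((P.men j).symm x : Fin n) : ℕ) = g.ptr j)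
    (hh : ∀ i : Fin n, h = i → (i = m ∧ x = w) ∨
      (i ≠ m ∧ (((P.men i).symm x : Fin n) : ℕ) = g.ptr i))
    (hlt : rankOf (P.women x) h < rankOf (P.women x) j) :
    g.ptr j + 1 ≤ leastCounts P m {w} j := by
  have hhn : h < n := by
    by_contra hcon
    have h1 := rankOf_le (P.women x) j
    have h2 : rankOf (P.women x) h = n := by simp [rankOf, hcon]
    omega
  refine Nat.succ_le_of_lt (lt_of_le_of_ne (hg.sound j hj) fun heq => ?_)
  refine closedCounts_leastCounts P m {w} j hj x (hx.trans heq) ⟨⟨h, hhn⟩, ?_, ?_⟩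
  · rcases hh ⟨h, hhn⟩ rfl with ⟨h1, h2⟩ | ⟨h1, h2⟩
    · exact Or.inl ⟨h1, h2⟩
    · exact Or.inr ⟨h1, h2.le.trans (hg.sound _ h1)⟩
  · have : rankOf (P.women x) (⟨h, hhn⟩ : Fin n) < rankOf (P.women x) j := hlt
    rw [rankOf_coe, rankOf_coe] at this
    exact this

theorem Inv.hold_cases (hg : g.Inv P m w) (x i : Fin n) (h : g.hold x = i) :
    (i = m ∧ x = w) ∨ (i ≠ m ∧ (((P.men i).symm x : Fin n) : ℕ) = g.ptr i) := by
  rcases eq_or_ne i m with rfl | hi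
  · exact Or.inl ⟨rfl, hg.hold_self x h⟩
  · exact Or.inr ⟨hi, (hg.hold_ptr x i hi h).1⟩

/-- Woman `x` accepts the proposal of `c`. -/
theorem Inv.accept (hg : g.Inv P m w) {c x : Fin n} (hc : g.cand = c) (hcm : c ≠ m)
    (hx : (((P.men c).symm x : Fin n) : ℕ) = g.ptr c)
    (hlt : rankOf (P.women x) c < rankOf (P.women x) (g.hold x)) :
    Inv P m w { g with
        ptr := Function.update g.ptr (g.hold x) (g.ptr (g.hold x) + 1)
        hold := Function.update g.hold x c
        cand := g.hold x } := by
  have hcn : (c : ℕ) < g.next := by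
    by_contra h
    exact (hg.fresh c hcm (by omega)).2 hc
  have hne : g.hold x ≠ c := by
    intro h
    rw [h] at hlt
    exact lt_irrefl _ hlt
  have hptr : ∀ j : ℕ, g.ptr j ≤ Function.update g.ptr (g.hold x) (g.ptr (g.hold x) + 1) j := by
    intro j
    rw [Function.update_apply]
    split_ifs with h
    · rw [h]
      omega
    · exact le_rfl
  -- A man other than `m` is held by at most one woman, the one his pointer indicates.
  have hinj : ∀ y, ∀ j : Fin n, j ≠ m → g.hold x = j → g.hold y = j → y = x := by
    intro y j hj h1 h2
    have e1 := (hg.hold_ptr x j hj h1).1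
    have e2 := (hg.hold_ptr y j hj h2).1
    exact (P.men j).symm.injective (Fin.ext (e2.trans e1.symm))
  have hhold : ∀ y, rankOf (P.women y) (Function.update g.hold x c y) ≤
      rankOf (P.women y) (g.hold y) := by
    intro y
    rw [Function.update_apply]
    split_ifs with h
    · rw [h]
      exact hlt.le
    · exact le_rfl
  have hsound : ∀ j : Fin n, j ≠ m →
      Function.update g.ptr (g.hold x) (g.ptr (g.hold x) + 1) j ≤ leastCounts P m {w} j := by
    intro j hj
    rw [Function.update_apply]
    split_ifs with h
    · rw [← h]
      rw [← h] at hlt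
      refine hg.lt_leastCounts hj (hg.hold_ptr x j hj h.symm).1 (fun i hi => Or.inr ?_) hlt
      have : c = i := Fin.ext hi
      subst this
      exact ⟨hcm, hx⟩
    · exact hg.sound j hj
  refine ⟨hg.hold_le x, hg.next_le, ?_, hg.ptr_self.trans (hptr m), hg.ptr_dummy.trans (hptr n),
    ?_, ?_, ?_, ?_, ?_, hsound, ?_, (hhold w).trans hg.improve_self⟩
  · intro y
    simp only [Function.update_apply]
    split_ifs
    · exact c.is_lt.le
    · exact hg.hold_le y
  · intro j hj
    simp only [Function.update_apply]
    split_ifs with h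
    · have := (hg.hold_ptr x j hj h.symm).1
      rw [← h]
      omega
    · exact hg.ptr_le j hj
  · intro y j hj h
    simp only [Function.update_apply] at h ⊢
    split_ifs at h with hy
    · have hcj : c = j := Fin.ext h
      subst hcj hy
      rw [if_neg (Ne.symm hne)]
      exact ⟨hx, hne, hcn⟩
    · have h1 := hg.hold_ptr y j hj h
      have h2 : (j : ℕ) ≠ g.hold x := fun h2 => hy (hinj y j hj h2.symm h)
      rw [if_neg h2]
      exact ⟨h1.1, Ne.symm h2, h1.2.2⟩
  · intro y h
    simp only [Function.update_apply] at h
    split_ifs at h with hy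
    · exact absurd (Fin.ext h) hcm
    · exact hg.hold_self y h
  · intro j hj h
    have h1 := hg.fresh j hj h
    have h2 : (j : ℕ) ≠ g.hold x := by
      intro h2
      have := (hg.hold_ptr x j hj h2.symm).2.2
      simp only at h
      omega
    simp only [Function.update_apply]
    rw [if_neg h2]
    exact ⟨h1.1, Ne.symm h2⟩
  · intro j hj h1 h2 h3
    simp only [Function.update_apply] at h1 h2 h3 ⊢
    rw [if_neg (Ne.symm h2)] at h3
    rcases eq_or_ne j c with rfl | hjc
    · exact ⟨x, by simp⟩
    · obtain ⟨y, hy⟩ := hg.engaged j hj h1 (fun h => hjc (Fin.ext (h.symm.trans hc))) h3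
      refine ⟨y, ?_⟩
      rw [if_neg, hy]
      rintro rfl
      exact h2 hy
  · intro j hj y h
    simp only [Function.update_apply] at h
    split_ifs at h with hjx
    · rcases Nat.lt_succ_iff_lt_or_eq.1 h with h' | h'
      · exact (hhold y).trans_lt (hg.improve j hj y (by rwa [hjx]))
      · have h2 := (hg.hold_ptr x j hj hjx.symm).1
        rw [← hjx] at h'
        have : y = x := (P.men j).symm.injective (Fin.ext (h'.trans h2.symm))
        subst this
        simp only [Function.update_self]
        rwa [hjx]
    · exact (hhold y).trans_lt (hg.improve j hj y h)

/-- Woman `x` rejects the proposal of `c`. -/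
theorem Inv.reject (hg : g.Inv P m w) {c x : Fin n} (hc : g.cand = c) (hcm : c ≠ m)
    (hx : (((P.men c).symm x : Fin n) : ℕ) = g.ptr c)
    (hlt : ¬ rankOf (P.women x) c < rankOf (P.women x) (g.hold x)) :
    Inv P m w { g with ptr := Function.update g.ptr c (g.ptr c + 1) } := by
  have hcn : (c : ℕ) < g.next := by
    by_contra h
    exact (hg.fresh c hcm (by omega)).2 hc
  have hne : ∀ y, g.hold y ≠ c := fun y h => (hg.hold_ptr y c hcm h).2.1 hc
  -- Equal ranks are excluded: the candidate is held by nobody, distinct men have distinct ranks,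
  -- and the dummy man has rank `n`, below every real man.
  have hlt' : rankOf (P.women x) (g.hold x) < rankOf (P.women x) c := by
    refine lt_of_le_of_ne (not_lt.1 hlt) fun h => ?_
    have hn : g.hold x < n := by
      by_contra hcon
      have h1 : rankOf (P.women x) (g.hold x) = n := by simp [rankOf, hcon]
      rw [rankOf_coe] at h
      omega
    have : (⟨g.hold x, hn⟩ : Fin n) = c := rankOf_inj (P.women x) h
    exact hne x (congrArg Fin.val this)
  have hptr : ∀ j : ℕ, g.ptr j ≤ Function.update g.ptr c (g.ptr c + 1) j := by
    intro j
    rw [Function.update_apply]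
    split_ifs with h
    · rw [h]
      omega
    · exact le_rfl
  refine ⟨hg.cand_le, hg.next_le, hg.hold_le, hg.ptr_self.trans (hptr m),
    hg.ptr_dummy.trans (hptr n), ?_, ?_, hg.hold_self, ?_, ?_, ?_, ?_, hg.improve_self⟩
  · intro j hj
    simp only [Function.update_apply]
    split_ifs with h
    · omega
    · exact hg.ptr_le j hj
  · intro y j hj h
    have h2 : (j : ℕ) ≠ c := fun h2 => hne y (h.trans h2)
    simp only [Function.update_apply, if_neg h2]
    exact hg.hold_ptr y j hj h
  · intro j hj h
    have h2 : (j : ℕ) ≠ c := by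
      simp only at h
      omega
    simp only [Function.update_apply, if_neg h2]
    exact hg.fresh j hj h
  · intro j hj h1 h2 h3
    have h4 : (j : ℕ) ≠ c := fun h4 => h2 (hc.trans h4.symm)
    simp only [Function.update_apply, if_neg h4] at h3
    exact hg.engaged j hj h1 h2 h3
  · intro j hj
    simp only [Function.update_apply]
    split_ifs with h
    · have : j = c := Fin.ext h
      subst this
      exact hg.lt_leastCounts hj hx (hg.hold_cases x) hlt'
    · exact hg.sound j hj
  · intro j hj y h
    simp only [Function.update_apply] at h
    split_ifs at h with hjx
    · have : j = c := Fin.ext hjx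
      subst this
      rcases Nat.lt_succ_iff_lt_or_eq.1 h with h' | h'
      · exact hg.improve j hj y h'
      · have : y = x := (P.men j).symm.injective (Fin.ext (h'.trans hx.symm))
        subst this
        exact hlt'
    · exact hg.improve j hj y h

/-- The next man becomes the candidate. -/
theorem Inv.advance (hg : g.Inv P m w) (hc : n ≤ g.ptr g.cand) (hn : g.next < n) :
    Inv P m w { g with cand := g.next, next := g.next + 1 } := by
  refine ⟨hn.le, hn, hg.hold_le, hg.ptr_self, hg.ptr_dummy, hg.ptr_le, ?_, hg.hold_self, ?_, ?_,
    hg.sound, hg.improve, hg.improve_self⟩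
  · intro y j hj h
    have := hg.hold_ptr y j hj h
    refine ⟨this.1, ?_, ?_⟩ <;> simp only <;> omega
  · intro j hj h
    simp only at h ⊢
    exact ⟨(hg.fresh j hj (by omega)).1, by omega⟩
  · intro j hj h1 h2 h3
    simp only at h1 h2 h3 ⊢
    refine hg.engaged j hj (by omega) ?_ h3
    intro h
    rw [h] at hc
    omega

theorem Inv.cand_ne (hg : g.Inv P m w) (h : g.cand < n ∧ g.ptr g.cand < n) :
    (⟨g.cand, h.1⟩ : Fin n) ≠ m := by
  intro hm
  have : g.cand = m := congrArg Fin.val hm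
  have h1 := hg.ptr_self
  rw [← this] at h1
  omega

theorem Inv.le_ptr_cand (hg : g.Inv P m w) (h : ¬ (g.cand < n ∧ g.ptr g.cand < n)) :
    n ≤ g.ptr g.cand := by
  by_contra hcon
  refine h ⟨lt_of_le_of_ne hg.cand_le fun hcn => ?_, by omega⟩
  have h1 := hg.ptr_dummy
  have h2 := congrArg g.ptr hcn
  omega

theorem Inv.step (hg : g.Inv P m w) : (g.step P).Inv P m w := by
  unfold Config.step
  split_ifs with h
  · dsimp only
    split_ifs with hlt
    · exact hg.accept (c := ⟨g.cand, h.1⟩) rfl (hg.cand_ne h) (by simp) hlt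
    · exact hg.reject (c := ⟨g.cand, h.1⟩) rfl (hg.cand_ne h) (by simp) hlt
  · exact hg.advance (hg.le_ptr_cand h) ‹_›
  · exact hg

/-- Number of rejections, considered men, and women who hold a proposal of a man besides `m`. -/
def potential (m : Fin n) (g : Config n) : ℕ :=
  ∑ j ∈ Finset.univ.erase m, g.ptr (j : Fin n) + g.next +
    (Finset.univ.filter fun x => g.hold x < n ∧ g.hold x ≠ m).card

theorem Inv.potential_le (hg : g.Inv P m w) : g.potential m ≤ n * n + 2 * n := by
  have h1 : ∑ j ∈ Finset.univ.erase m, g.ptr (j : Fin n) ≤ n * n := by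
    refine (Finset.sum_le_card_nsmul _ _ n fun j hj =>
      hg.ptr_le j (Finset.ne_of_mem_erase hj)).trans ?_
    rw [smul_eq_mul]
    refine Nat.mul_le_mul_right n ?_
    simp
  have h2 : (Finset.univ.filter fun x => g.hold x < n ∧ g.hold x ≠ m).card ≤ n := by
    simpa using (Finset.univ.filter fun x => g.hold x < n ∧ g.hold x ≠ m).card_le_univ
  have h3 := hg.next_le
  unfold potential
  omega

theorem potential_lt_of_sum {g' : Config n} (hs : ∀ j : ℕ, g.ptr j ≤ g'.ptr j)
    (j : Fin n) (hj : j ≠ m) (hlt : g.ptr j < g'.ptr j) (hn : g.next = g'.next)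
    (hh : ∀ x, g.hold x < n ∧ g.hold x ≠ m → g'.hold x < n ∧ g'.hold x ≠ m) :
    g.potential m < g'.potential m := by
  unfold potential
  have h1 : ∑ j ∈ Finset.univ.erase m, g.ptr (j : Fin n) <
      ∑ j ∈ Finset.univ.erase m, g'.ptr (j : Fin n) :=
    Finset.sum_lt_sum (fun i _ => hs i) ⟨j, by simp [hj], hlt⟩
  have h2 := Finset.card_le_card (Finset.monotone_filter_right Finset.univ fun x _ => hh x)
  omega

theorem potential_lt_of_hold {g' : Config n} (hs : ∀ j : ℕ, g.ptr j ≤ g'.ptr j)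
    (hn : g.next = g'.next)
    (hh : ∀ x, g.hold x < n ∧ g.hold x ≠ m → g'.hold x < n ∧ g'.hold x ≠ m)
    (x : Fin n) (hx : ¬ (g.hold x < n ∧ g.hold x ≠ m)) (hx' : g'.hold x < n ∧ g'.hold x ≠ m) :
    g.potential m < g'.potential m := by
  unfold potential
  have h1 : ∑ j ∈ Finset.univ.erase m, g.ptr (j : Fin n) ≤
      ∑ j ∈ Finset.univ.erase m, g'.ptr (j : Fin n) :=
    Finset.sum_le_sum (fun i _ => hs i)
  have h2 : (Finset.univ.filter fun x => g.hold x < n ∧ g.hold x ≠ m).card <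
      (Finset.univ.filter fun x => g'.hold x < n ∧ g'.hold x ≠ m).card := by
    refine Finset.card_lt_card (Finset.ssubset_iff_subset_ne.2
      ⟨Finset.monotone_filter_right Finset.univ fun x _ => hh x, fun heq => hx ?_⟩)
    have : x ∈ Finset.univ.filter fun x => g'.hold x < n ∧ g'.hold x ≠ m := by simpa using hx'
    rw [← heq] at this
    simpa using this
  omega

theorem le_update_succ (f : ℕ → ℕ) (a j : ℕ) : f j ≤ Function.update f a (f a + 1) j := by
  rw [Function.update_apply]
  split_ifs with h
  · rw [h]
    omega
  · exact le_rfl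

/-- A rejection, or the displacement of a man other than `m`, raises a pointer in the sum.
Displacing `m` or the dummy man does not, but then one more woman holds a man other than `m`.
Passing to the next man raises `next`. -/
theorem Inv.potential_step (hg : g.Inv P m w) (hd : ¬ g.Done) :
    g.potential m < (g.step P).potential m := by
  unfold Config.step
  split_ifs with h hn
  · have hcm := hg.cand_ne h
    have hcm' : g.cand ≠ m := fun h => hcm (Fin.ext h)
    dsimp only
    set x := P.men ⟨g.cand, h.1⟩ ⟨g.ptr g.cand, h.2⟩
    split_ifs with hlt
    · have hh : ∀ y, g.hold y < n ∧ g.hold y ≠ m →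
          Function.update g.hold x g.cand y < n ∧ Function.update g.hold x g.cand y ≠ m := by
        intro y hy
        rw [Function.update_apply]
        split_ifs
        · exact ⟨h.1, hcm'⟩
        · exact hy
      by_cases hreal : g.hold x < n ∧ g.hold x ≠ m
      · refine potential_lt_of_sum (le_update_succ _ _) ⟨g.hold x, hreal.1⟩
          (fun h => hreal.2 (congrArg Fin.val h)) ?_ rfl hh
        simp
      · refine potential_lt_of_hold (le_update_succ _ _) rfl hh x hreal ?_
        simp only [Function.update_self]
        exact ⟨h.1, hcm'⟩
    · refine potential_lt_of_sum (le_update_succ _ _) ⟨g.cand, h.1⟩ hcm ?_ rfl fun _ h => h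
      simp
  · simp only [potential]
    omega
  · exact absurd ⟨by omega, hg.le_ptr_cand h⟩ hd

/-- Finished runs idle, so the program may make a fixed number of steps without testing for the end.
-/
theorem step_of_done (hd : g.Done) : g.step P = g := by
  unfold Config.step
  rw [dif_neg (fun h => by have := hd.2; omega), if_neg (by have := hd.1; omega)]

/-- When the run is over, `m` has been rejected by `w` if and only if `w` is in `passSet P m`. -/
theorem Inv.hold_ne_iff (hg : g.Inv P m w) (hd : g.Done) : g.hold w ≠ m ↔ w ∈ passSet P m := by
  have heng : ∀ j : Fin n, j ≠ m → ∀ x, (((P.men j).symm x : Fin n) : ℕ) = g.ptr j →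
      g.hold x = j := by
    intro j hj x hx
    have hlt : g.ptr j < n := hx ▸ Fin.is_lt _
    obtain ⟨y, hy⟩ := hg.engaged j hj (j.is_lt.trans_le hd.1)
      (fun h => by have := hd.2; rw [h] at this; omega) hlt
    have := (hg.hold_ptr y j hj hy).1
    rwa [(P.men j).symm.injective (Fin.ext (hx.trans this.symm))]
  have himp : ∀ j : Fin n, j ≠ m → ∀ x, (((P.men j).symm x : Fin n) : ℕ) ≤ g.ptr j →
      rankOf (P.women x) (g.hold x) ≤ rankOf (P.women x) j := by
    intro j hj x hx
    rcases hx.lt_or_eq with h | h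
    · exact (hg.improve j hj x h).le
    · rw [heng j hj x h]
  -- Every standing proposal is held at the end, and every woman holds the best proposal made to
  -- her, that of `m` to `w` included.
  have hclosed : ClosedCounts P m {w} fun j => g.ptr j := by
    rintro j hj x hx ⟨i, hi, hpref⟩
    have h1 : rankOf (P.women x) (i : Fin n) < rankOf (P.women x) j := by
      rw [rankOf_coe, rankOf_coe]
      exact hpref
    rw [← heng j hj x hx] at h1
    rcases hi with ⟨rfl, hxw⟩ | ⟨hi, hle⟩
    · obtain rfl : x = w := hxw
      exact absurd h1 (not_lt.2 hg.improve_self)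
    · exact absurd h1 (not_lt.2 (himp i hi x hle))
  have heq : ∀ j : Fin n, j ≠ m → leastCounts P m {w} j = g.ptr j := fun j hj =>
    (leastCounts_le hclosed j).antisymm (hg.sound j hj)
  constructor
  · intro hne
    have hn : g.hold w < n := by
      by_contra hcon
      have h1 : rankOf (P.women w) (g.hold w) = n := by simp [rankOf, hcon]
      have h2 := hg.improve_self
      rw [rankOf_coe] at h2
      omega
    set j : Fin n := ⟨g.hold w, hn⟩ with hjdef
    have hj : j ≠ m := fun h => hne (congrArg Fin.val h)
    refine ⟨j, Or.inr ⟨hj, ?_⟩, ?_⟩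
    · rw [heq j hj]
      exact (hg.hold_ptr w j hj rfl).1.le
    · have h1 : rankOf (P.women w) j ≤ rankOf (P.women w) m := hg.improve_self
      have h2 := lt_of_le_of_ne h1 fun h => hj (rankOf_inj _ h)
      rw [rankOf_coe, rankOf_coe] at h2
      exact h2
  · rintro ⟨j, hj | ⟨hj, hle⟩, hpref⟩ heq'
    · rw [hj.1] at hpref
      exact lt_irrefl _ hpref
    · rw [heq j hj] at hle
      have h1 := himp j hj w hle
      rw [heq', rankOf_coe, rankOf_coe] at h1
      exact absurd hpref (not_lt.2 h1)

end

theorem inv_iterate (P : Profile n) (m w : Fin n) (t : ℕ) :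
    ((step P)^[t] (start m w)).Inv P m w := by
  induction t with
  | zero => exact inv_start P m w
  | succ t ih =>
    rw [Function.iterate_succ_apply']
    exact ih.step

/-- The invariant gives no upper bound on the pointers of `m` and of the dummy man, which can exceed
`n`; this crude bound keeps them within a word. -/
theorem ptr_iterate_le (P : Profile n) (m w : Fin n) (t j : ℕ) :
    ((step P)^[t] (start m w)).ptr j ≤ n + t := by
  induction t generalizing j with
  | zero =>
    simp only [Function.iterate_zero, id, start]
    split_ifs <;> omega
  | succ t ih =>
    rw [Function.iterate_succ_apply']
    set g := (step P)^[t] (start m w)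
    have h0 := ih j
    have hup : ∀ a, Function.update g.ptr a (g.ptr a + 1) j ≤ n + (t + 1) := by
      intro a
      have := ih a
      rw [Function.update_apply]
      split_ifs <;> omega
    unfold step
    split_ifs
    · dsimp only
      split_ifs
      · exact hup _
      · exact hup _
    · dsimp only
      omega
    · omega

/-- Until the run is over the potential rises in every step, and it is at most `n * n + 2 * n`. -/
theorem done_iterate (P : Profile n) (m w : Fin n) {t : ℕ} (ht : n * n + 2 * n < t) :
    ((step P)^[t] (start m w)).Done := by
  have key : ∀ t, ((step P)^[t] (start m w)).Done ∨
      t ≤ ((step P)^[t] (start m w)).potential m := by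
    intro t
    induction t with
    | zero => exact Or.inr (Nat.zero_le _)
    | succ t ih =>
      rw [Function.iterate_succ_apply']
      by_cases hd : ((step P)^[t] (start m w)).Done
      · left
        rwa [step_of_done hd]
      · right
        have h1 := ih.resolve_left hd
        have h2 := (inv_iterate P m w t).potential_step hd
        omega
  refine (key t).resolve_right fun h => ?_
  have := (inv_iterate P m w t).potential_le
  omega

end Config

/-! ### Tables in memory -/

/-- Distinct entries of a table occupy distinct cells, so that a write spoils no other entry. -/
theorem mul_add_inj {N a b i j : ℕ} (ha : a < N) (hb : b < N) (h : i * N + a = j * N + b) :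
    i = j ∧ a = b := by
  have hN : 0 < N := by omega
  have h1 := congrArg (· % N) h
  have h2 := congrArg (· / N) h
  simp only [Nat.mul_add_mod_self_right, Nat.mod_eq_of_lt ha, Nat.mod_eq_of_lt hb] at h1
  subst h1
  exact ⟨Nat.eq_of_mul_eq_mul_right hN (by omega), rfl⟩

theorem table_apply (T : Fin n → PrefList n) {i j : ℕ} (hi : i < n) (hj : j < n) :
    table T (i * n + j) = ((T ⟨i, hi⟩ ⟨j, hj⟩ : Fin n) : ℕ) := by
  have hlt : i * n + j < n * n := by nlinarith
  have h1 : (i * n + j) / n = i := by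
    rw [add_comm, Nat.add_mul_div_right _ _ (by omega), Nat.div_eq_of_lt hj, zero_add]
  have h2 : (i * n + j) % n = j := by
    rw [Nat.mul_add_mod_self_right, Nat.mod_eq_of_lt hj]
  unfold table
  rw [dif_pos hlt]
  have e1 : Fin.divNat (⟨i * n + j, hlt⟩ : Fin (n * n)) = ⟨i, hi⟩ := Fin.ext h1
  have e2 : Fin.modNat (⟨i * n + j, hlt⟩ : Fin (n * n)) = ⟨j, hj⟩ := Fin.ext h2
  rw [e1, e2]

/-- The expression for the cell in row `e`, column `i` of a table with rows of length `N`. -/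
def Expr.cell (N e i : Expr) : Expr := .bin .add (.bin .mul e N) i

/-- The input is in its place. -/
structure InputKept (P : Profile n) (m : Fin n) (s : State) : Prop where
  reg_zero : s.reg 0 = n
  reg_one : s.reg 1 = m
  arr_zero : s.arr 0 = table P.men
  arr_one : s.arr 1 = table P.women

theorem inputKept_inputState (P : Profile n) (m : Fin n) : InputKept P m (inputState P m) :=
  ⟨rfl, rfl, rfl, rfl⟩

theorem InputKept.setReg {P : Profile n} {m : Fin n} {s : State} (h : InputKept P m s) {x : ℕ}
    (hx : 2 ≤ x) (v : ℕ) : InputKept P m (s.setReg x v) := by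
  obtain ⟨h1, h2, h3, h4⟩ := h
  refine ⟨?_, ?_, h3, h4⟩
  · simp only [State.setReg]
    rw [Function.update_of_ne (by omega), h1]
  · simp only [State.setReg]
    rw [Function.update_of_ne (by omega), h2]

theorem InputKept.setArr {P : Profile n} {m : Fin n} {s : State} (h : InputKept P m s) {a : ℕ}
    (ha : 2 ≤ a) (i v : ℕ) : InputKept P m (s.setArr a i v) := by
  obtain ⟨h1, h2, h3, h4⟩ := h
  refine ⟨h1, h2, ?_, ?_⟩
  · simp only [State.setArr]
    rw [Function.update_of_ne (by omega), h3]
  · simp only [State.setArr]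
    rw [Function.update_of_ne (by omega), h4]

theorem State.reg_setReg (s : State) (x v y : ℕ) :
    (s.setReg x v).reg y = if y = x then v else s.reg y :=
  Function.update_apply _ _ _ _

theorem State.arr_setReg (s : State) (x v : ℕ) : (s.setReg x v).arr = s.arr := rfl

theorem State.reg_setArr (s : State) (a i v : ℕ) : (s.setArr a i v).reg = s.reg := rfl

theorem State.arr_setArr (s : State) (a i v b j : ℕ) :
    (s.setArr a i v).arr b j = if b = a ∧ j = i then v else s.arr b j := by
  simp only [State.setArr, Function.update_apply]
  by_cases hb : b = a
  · subst hb
    by_cases hj : j = i <;> simp [hj]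
  · simp [hb]

theorem row_le {w j : ℕ} (hw : w < n) (hj : j ≤ n) : w * n + j ≤ n * n := by nlinarith

theorem wide_row_le {w j : ℕ} (hw : w < n) (hj : j ≤ n) : w * (n + 1) + j ≤ 2 * (n * n) := by
  nlinarith

/-! ### The ranks of the men -/

/-- Row `w` of array `4` holds the ranks of the men (and of the dummy man) for woman `w`. -/
def rankProg : Prog :=
  .forLoop 2 (.reg 0) (.seq
    (.forLoop 3 (.reg 0)
      (.write 4 (.cell (.bin .add (.reg 0) (.lit 1)) (.reg 2)
          (.read 1 (.cell (.reg 0) (.reg 2) (.reg 3))))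
        (.reg 3)))
    (.write 4 (.cell (.bin .add (.reg 0) (.lit 1)) (.reg 2) (.reg 0)) (.reg 0)))

/-- The first `k` women have their rows in array `4`. -/
def HasRanks (P : Profile n) (k : ℕ) (s : State) : Prop :=
  ∀ w : Fin n, (w : ℕ) < k → ∀ j, j ≤ n → s.arr 4 (w * (n + 1) + j) = rankOf (P.women w) j

/-- Inverting the women's lists beforehand makes every comparison of two suitors a constant-time
lookup. Rows have length `n + 1`, the last cell being that of the dummy man. -/
theorem runsIn_rankProg (P : Profile n) (m : Fin n) {B : ℕ} (hB : 20 * (n * n) ≤ B) {s : State}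
    (hs : InputKept P m s) :
    RunsIn B rankProg s (100 * (n * n)) fun s' => InputKept P m s' ∧ HasRanks P n s' := by
  have hn : 0 < n := m.pos
  have hnn : n ≤ n * n := Nat.le_mul_self n
  refine (RunsIn.forLoop (N := n) (T := 30 * n + 20) (fun k s => InputKept P m s ∧ s.reg 2 = k ∧
    HasRanks P k s) (by omega) ?_ ?_ ?_).mono ?_ ?_
  · exact ⟨hs.setReg le_rfl 0, by simp [State.reg_setReg],
      fun w hw => absurd hw (Nat.not_lt_zero _)⟩
  · rintro k s ⟨h1, h2, -⟩
    refine ⟨h2, ?_, h1.reg_zero⟩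
    simp only [Expr.Fits, h1.reg_zero]
    omega
  · rintro w s hw ⟨h1, h2, h3⟩
    refine RunsIn.seq (30 * n + 6) 14 (by omega) ((RunsIn.forLoop (N := n) (T := 15)
      (fun k s => InputKept P m s ∧ s.reg 2 = w ∧ s.reg 3 = k ∧ HasRanks P w s ∧
        ∀ j : Fin n, (((P.women ⟨w, hw⟩).symm j : Fin n) : ℕ) < k →
          s.arr 4 (w * (n + 1) + j) = rankOf (P.women ⟨w, hw⟩) j)
      (by omega) ?_ ?_ ?_).mono ?_ ?_)
    · exact ⟨h1.setReg (by omega) 0, by simp [State.reg_setReg, h2], by simp [State.reg_setReg], h3,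
        fun j hj => absurd hj (Nat.not_lt_zero _)⟩
    · rintro k s ⟨h1, h2, h3, -⟩
      refine ⟨h3, ?_, h1.reg_zero⟩
      simp only [Expr.Fits, h1.reg_zero]
      omega
    · rintro k s hk ⟨h1, h2, h3, h4, h5⟩
      set j := P.women ⟨w, hw⟩ ⟨k, hk⟩ with hj
      have hcell : table P.women (w * n + k) = j := table_apply _ hw hk
      have b1 := row_le hw hk.le
      have b2 := wide_row_le hw j.is_lt.le
      refine RunsIn.write ?_ ?_ ?_ ?_
      · simp only [Expr.Fits, Expr.eval, Op.eval, Expr.cell, h1.reg_zero, h1.arr_one, h2, h3, hcell]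
        omega
      · simp only [Expr.Fits, h3]
        omega
      · simp [Expr.cost, Expr.cell]
      · simp only [Expr.eval, Op.eval, Expr.cell, h1.reg_zero, h1.arr_one, h2, h3, hcell]
        refine ⟨h3, (h1.setArr (by omega) _ _).setReg (by omega) _,
          by simp [State.reg_setReg, State.reg_setArr, h2],
          by simp [State.reg_setReg], ?_, ?_⟩
        · intro v hv i hi
          rw [State.arr_setReg, State.arr_setArr, if_neg, h4 v hv i hi]
          rintro ⟨-, h⟩
          have := (mul_add_inj (by omega) (by omega) h).1
          omega
        · intro i hi
          rw [State.arr_setReg, State.arr_setArr]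
          split_ifs with h
          · have hij : i = j := Fin.ext (mul_add_inj (by omega) (by omega) h.2).2
            rw [hij, rankOf_coe, hj, Equiv.symm_apply_apply]
          · refine h5 i (lt_of_le_of_ne (Nat.lt_succ_iff.1 hi) fun hik => h ⟨rfl, ?_⟩)
            have : (P.women ⟨w, hw⟩).symm i = ⟨k, hk⟩ := Fin.ext hik
            rw [hj, ← this, Equiv.apply_symm_apply]
    · simp only [Expr.cost]
      omega
    · rintro s ⟨h1, h2, h3, h4, h5⟩
      have b2 := wide_row_le hw (le_refl n)
      refine RunsIn.write ?_ ?_ ?_ ?_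
      · simp only [Expr.Fits, Expr.eval, Op.eval, Expr.cell, h1.reg_zero, h2]
        omega
      · simp only [Expr.Fits, h1.reg_zero]
        omega
      · simp [Expr.cost, Expr.cell]
      · simp only [Expr.eval, Op.eval, Expr.cell, h1.reg_zero, h2]
        refine ⟨h2, (h1.setArr (by omega) _ _).setReg (by omega) _, by simp [State.reg_setReg], ?_⟩
        intro v hv i hi
        rw [State.arr_setReg, State.arr_setArr]
        split_ifs with h
        · obtain rfl := (mul_add_inj (by omega) (by omega) h.2).2
          simp [rankOf]
        · rcases Nat.lt_succ_iff_lt_or_eq.1 hv with hv' | hv'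
          · exact h4 v hv' i hi
          · subst hv'
            have hi' : i < n := lt_of_le_of_ne hi fun hin => h ⟨rfl, by rw [hin]⟩
            exact h5 ⟨i, hi'⟩ (Fin.is_lt _)
  · simp only [Expr.cost]
    nlinarith
  · exact fun s hs => ⟨hs.1, hs.2.2⟩

/-! ### The women who reject `m` -/

/-- Prepare arrays `6`, `7` and registers `4`, `5` for the run with `m` proposing to woman `2`. -/
def startProg : Prog :=
  .seq (.forLoop 3 (.reg 0) (.seq (.write 6 (.reg 3) (.lit 0)) (.write 7 (.reg 3) (.reg 0))))
    (.seq (.write 6 (.reg 1) (.reg 0)) (.seq (.write 6 (.reg 0) (.reg 0))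
      (.seq (.write 7 (.reg 2) (.reg 1)) (.seq (.assign 4 (.reg 0)) (.assign 5 (.lit 0))))))

/-- The candidate in register `4` makes a proposal, or is replaced by the next man. -/
def stepProg : Prog :=
  .cond (.bin .lt (.read 6 (.reg 4)) (.reg 0))
    (.seq (.assign 6 (.read 0 (.cell (.reg 0) (.reg 4) (.read 6 (.reg 4)))))
      (.seq (.assign 7 (.read 7 (.reg 6)))
        (.seq
          (.cond
            (.bin .lt (.read 4 (.cell (.bin .add (.reg 0) (.lit 1)) (.reg 6) (.reg 4)))
              (.read 4 (.cell (.bin .add (.reg 0) (.lit 1)) (.reg 6) (.reg 7))))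
            (.seq (.write 7 (.reg 6) (.reg 4)) (.assign 4 (.reg 7)))
            .skip)
          (.write 6 (.reg 4) (.bin .add (.read 6 (.reg 4)) (.lit 1))))))
    (.cond (.bin .lt (.reg 5) (.reg 0))
      (.seq (.assign 4 (.reg 5)) (.assign 5 (.bin .add (.reg 5) (.lit 1))))
      .skip)

/-- Array `5` gets the indicator function of the women who reject `m`. -/
def passProg : Prog :=
  .forLoop 2 (.reg 0) (.seq startProg (.seq
    (.forLoop 3 (.bin .mul (.lit 4) (.bin .mul (.reg 0) (.reg 0))) stepProg)
    (.cond (.bin .eq (.read 7 (.reg 2)) (.reg 1)) (.write 5 (.reg 2) (.lit 0))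
      (.write 5 (.reg 2) (.lit 1)))))

/-- The configuration `g` is stored in arrays `6`, `7` and registers `4`, `5`. -/
structure Config.Stored (g : Config n) (s : State) : Prop where
  ptr : ∀ j, j ≤ n → s.arr 6 j = g.ptr j
  hold : ∀ x : Fin n, s.arr 7 x = g.hold x
  cand : s.reg 4 = g.cand
  next : s.reg 5 = g.next

/-- Input, rank table and the women considered so far. -/
structure PassInv (P : Profile n) (m : Fin n) (k : ℕ) (s : State) : Prop where
  input : InputKept P m s
  ranks : HasRanks P n s
  counter : s.reg 2 = k
  mem : ∀ w : Fin n, (w : ℕ) < k → w ∈ passSet P m → s.arr 5 w = 1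
  notMem : ∀ w : Fin n, (w : ℕ) < k → w ∉ passSet P m → s.arr 5 w = 0

/-- Registers from `3` and arrays from `6` on are scratch space for the simulated run. -/
theorem PassInv.congr {P : Profile n} {m : Fin n} {k : ℕ} {s s' : State} (h : PassInv P m k s)
    (hr : ∀ y, y < 3 → s'.reg y = s.reg y) (ha : ∀ a, a < 6 → s'.arr a = s.arr a) :
    PassInv P m k s' := by
  obtain ⟨⟨h1, h2, h3, h4⟩, h5, h6, h7, h8⟩ := h
  refine ⟨⟨?_, ?_, ?_, ?_⟩, fun w hw j hj => ?_, ?_, fun w hw hm => ?_, fun w hw hm => ?_⟩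
  · rw [hr 0 (by omega), h1]
  · rw [hr 1 (by omega), h2]
  · rw [ha 0 (by omega), h3]
  · rw [ha 1 (by omega), h4]
  · rw [ha 4 (by omega), h5 w hw j hj]
  · rw [hr 2 (by omega), h6]
  · rw [ha 5 (by omega), h7 w hw hm]
  · rw [ha 5 (by omega), h8 w hw hm]

theorem State.arr_setArr_of_ne (s : State) {a b : ℕ} (i v : ℕ) (h : b ≠ a) :
    (s.setArr a i v).arr b = s.arr b :=
  Function.update_of_ne h _ _

theorem State.reg_setReg_of_ne (s : State) {x y : ℕ} (v : ℕ) (h : y ≠ x) :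
    (s.setReg x v).reg y = s.reg y :=
  Function.update_of_ne h _ _

theorem PassInv.setReg {P : Profile n} {m : Fin n} {k : ℕ} {s : State} (h : PassInv P m k s)
    {x : ℕ} (hx : 3 ≤ x) (v : ℕ) : PassInv P m k (s.setReg x v) :=
  h.congr (fun y hy => s.reg_setReg_of_ne v (by omega)) (fun _ _ => rfl)

theorem PassInv.setArr {P : Profile n} {m : Fin n} {k : ℕ} {s : State} (h : PassInv P m k s)
    {a : ℕ} (ha : 6 ≤ a) (i v : ℕ) : PassInv P m k (s.setArr a i v) :=
  h.congr (fun _ _ => rfl) (fun b hb => s.arr_setArr_of_ne i v (by omega))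

theorem runsIn_startProg (P : Profile n) (m w : Fin n) {B : ℕ} (hB : 20 * (n * n) ≤ B) {s : State}
    (hs : PassInv P m w s) :
    RunsIn B startProg s (50 * n) fun s' => PassInv P m w s' ∧ (Config.start m w).Stored s' := by
  have hn : 0 < n := m.pos
  have hnn : n ≤ n * n := Nat.le_mul_self n
  have hmn := m.is_lt
  have hwn := w.is_lt
  refine RunsIn.seq (20 * n + 6) 20 (by omega) ((RunsIn.forLoop (N := n) (T := 10)
    (fun k s => PassInv P m w s ∧ s.reg 3 = k ∧ ∀ j, j < k → s.arr 6 j = 0 ∧ s.arr 7 j = n)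
      (by omega) ?_ ?_ ?_).mono ?_ ?_)
  · exact ⟨hs.setReg (by omega) 0, by simp [State.reg_setReg],
      fun j hj => absurd hj (Nat.not_lt_zero _)⟩
  · rintro k s ⟨h1, h2, -⟩
    refine ⟨h2, ?_, h1.input.reg_zero⟩
    simp only [Expr.Fits, h1.input.reg_zero]
    omega
  · rintro k s hk ⟨h1, h2, h3⟩
    refine RunsIn.write_seq ?_ ?_ (by simp [Expr.cost])
      (RunsIn.write ?_ ?_ (by simp [Expr.cost]) ?_)
    · simp only [Expr.Fits]
      omega
    · simp only [Expr.Fits]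
      omega
    · simp only [Expr.Fits, State.reg_setArr]
      omega
    · simp only [Expr.Fits, State.reg_setArr, h1.input.reg_zero]
      omega
    · simp only [Expr.eval, State.reg_setArr, h1.input.reg_zero, h2]
      refine ⟨trivial, ((h1.setArr (by omega) _ _).setArr (by omega) _ _).setReg (by omega) _,
        by simp [State.reg_setReg], fun j hj => ?_⟩
      simp only [State.arr_setReg, State.arr_setArr]
      rcases Nat.lt_succ_iff_lt_or_eq.1 hj with h | h
      · simp [h.ne, h3 j h]
      · simp [h]
  · simp only [Expr.cost]
    omega
  · rintro s ⟨h1, h2, h3⟩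
    have r0 := h1.input.reg_zero
    have r1 := h1.input.reg_one
    have r2 := h1.counter
    refine RunsIn.write_seq ?_ ?_ (by simp [Expr.cost])
      (RunsIn.write_seq ?_ ?_ (by simp [Expr.cost])
        (RunsIn.write_seq ?_ ?_ (by simp [Expr.cost]) (RunsIn.assign_seq ?_ (by simp [Expr.cost])
        (RunsIn.assign ?_ (by simp [Expr.cost]) ?_))))
    iterate 8
      · simp only [Expr.Fits, Expr.eval, State.reg_setArr]
        omega
    simp only [Expr.eval, State.reg_setArr, r0, r1, r2]
    refine ⟨((((h1.setArr (by omega) _ _).setArr (by omega) _ _).setArr (by omega) _ _).setReg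
      (by omega) _).setReg (by omega) _, ?_, ?_, ?_, ?_⟩
    · intro j hj
      simp only [State.arr_setReg, State.arr_setArr, Config.start]
      by_cases hjn : j = n
      · simp [hjn]
      · by_cases hjm : j = m
        · simp [hjm]
        · simp [hjn, hjm, (h3 j (by omega)).1]
    · intro x
      simp only [State.arr_setReg, State.arr_setArr, Config.start, Fin.val_inj]
      by_cases hxw : x = w
      · simp [hxw]
      · simp [hxw, (h3 x x.is_lt).2]
    · simp [State.reg_setReg, Config.start]
    · simp [State.reg_setReg, Config.start]

theorem runsIn_stepProg {P : Profile n} {m w : Fin n} {B k t : ℕ} (hB : 20 * (n * n) ≤ B)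
    {s : State} (hs : PassInv P m k s) {g : Config n} (hg : g.Inv P m w) (hgs : g.Stored s)
    (hptr : ∀ j, g.ptr j ≤ 6 * (n * n)) (ht : s.reg 3 = t) :
    RunsIn B stepProg s 60 fun s' =>
      PassInv P m k s' ∧ s'.reg 3 = t ∧ (g.step P).Stored s' := by
  have hn : 0 < n := m.pos
  have hnn : n ≤ n * n := Nat.le_mul_self n
  have r0 := hs.input.reg_zero
  have a0 := hs.input.arr_zero
  have r4 := hgs.cand
  have r5 := hgs.next
  have hcn := hg.cand_le
  have hnx := hg.next_le
  have hpc := hgs.ptr _ hcn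
  have hpb := hptr g.cand
  refine RunsIn.cond ?_ (by simp [Expr.cost]) ?_ ?_
  · simp only [Expr.Fits, Expr.eval, Op.eval, r0, r4, hpc]
    exact ⟨⟨by omega, by omega⟩, by omega, (ite_one_zero_le _).trans (by omega)⟩
  · intro htest
    simp only [Expr.eval, Op.eval, r0, r4, hpc, ne_eq, ite_eq_right_iff, one_ne_zero, imp_false,
      not_not] at htest
    -- The program tests only the pointer; this suffices, as the dummy man has a pointer of at least
    -- `n`.
    have hc : g.cand < n := lt_of_le_of_ne hcn fun h => by
      have h1 := hg.ptr_dummy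
      have h2 := congrArg g.ptr h
      omega
    have hstep : g.step P = if rankOf (P.women (P.men ⟨g.cand, hc⟩ ⟨_, htest⟩)) g.cand <
        rankOf (P.women (P.men ⟨g.cand, hc⟩ ⟨_, htest⟩))
          (g.hold (P.men ⟨g.cand, hc⟩ ⟨_, htest⟩)) then
      { g with
        ptr := Function.update g.ptr (g.hold (P.men ⟨g.cand, hc⟩ ⟨_, htest⟩))
          (g.ptr (g.hold (P.men ⟨g.cand, hc⟩ ⟨_, htest⟩)) + 1)
        hold := Function.update g.hold (P.men ⟨g.cand, hc⟩ ⟨_, htest⟩) g.cand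
        cand := g.hold (P.men ⟨g.cand, hc⟩ ⟨_, htest⟩) }
      else { g with ptr := Function.update g.ptr g.cand (g.ptr g.cand + 1) } := by
      unfold Config.step
      rw [dif_pos ⟨hc, htest⟩]
    have hcell : table P.men (g.cand * n + g.ptr g.cand) =
      (P.men ⟨g.cand, hc⟩ ⟨_, htest⟩ : Fin n) := table_apply _ hc htest
    generalize P.men ⟨g.cand, hc⟩ ⟨_, htest⟩ = x at hstep hcell
    have b1 := row_le hc htest.le
    have hx := x.is_lt
    have hh := hg.hold_le x
    have h7 := hgs.hold x
    have b2 := wide_row_le hx hcn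
    have b3 := wide_row_le hx hh
    have k1 := hs.ranks x hx _ hcn
    have k2 := hs.ranks x hx _ hh
    have l1 := rankOf_le (P.women x) g.cand
    have l2 := rankOf_le (P.women x) (g.hold x)
    have hph := hgs.ptr _ hh
    have hphb := hptr (g.hold x)
    refine RunsIn.assign_seq ?_ (by simp [Expr.cost, Expr.cell]) ?_
    · simp only [Expr.Fits, Expr.eval, Op.eval, Expr.cell, r0, r4, hpc, a0, hcell]
      omega
    simp only [Expr.eval, Op.eval, Expr.cell, r0, r4, hpc, a0, hcell]
    refine RunsIn.assign_seq ?_ (by simp [Expr.cost]) ?_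
    · simp only [Expr.Fits, Expr.eval, State.reg_setReg, State.arr_setReg, if_true, h7]
      omega
    simp only [Expr.eval, State.reg_setReg, State.arr_setReg, if_true, h7]
    set s₁ := (s.setReg 6 x).setReg 7 (g.hold x) with hs₁
    have p₁ : PassInv P m k s₁ := (hs.setReg (by omega) _).setReg (by omega) _
    have q0 : s₁.reg 0 = n := p₁.input.reg_zero
    have q3 : s₁.reg 3 = t := by simp [hs₁, State.reg_setReg, ht]
    have q4 : s₁.reg 4 = g.cand := by simp [hs₁, State.reg_setReg, r4]
    have q5 : s₁.reg 5 = g.next := by simp [hs₁, State.reg_setReg, r5]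
    have q6 : s₁.reg 6 = x := by simp [hs₁, State.reg_setReg]
    have q7 : s₁.reg 7 = g.hold x := by simp [hs₁, State.reg_setReg]
    have qa : s₁.arr = s.arr := rfl
    -- After the inner test register `4` names the rejected man in either case, the displaced one or
    -- the candidate himself, so one common instruction raises his pointer.
    refine RunsIn.seq 30 6 (by simp [Expr.cost]) (RunsIn.cond ?_ (by simp [Expr.cost]) ?_ ?_)
    · simp only [Expr.Fits, Expr.eval, Op.eval, q0, q4, q6, q7, qa, k1, k2]
      exact ⟨by omega, by omega, (ite_one_zero_le _).trans (by omega)⟩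
    · intro hlt
      simp only [Expr.eval, Op.eval, q0, q4, q6, q7, qa, k1, k2, ne_eq,
        ite_eq_right_iff, one_ne_zero, imp_false, not_not] at hlt
      rw [if_pos hlt] at hstep
      refine RunsIn.write_seq ?_ ?_ (by simp [Expr.cost]) (RunsIn.assign ?_ (by simp [Expr.cost])
        (RunsIn.write ?_ ?_ (by simp [Expr.cost]) ?_))
      · simp only [Expr.Fits, q6]
        omega
      · simp only [Expr.Fits, q4]
        omega
      · simp only [Expr.Fits, State.reg_setArr, q7]
        omega
      · simp only [Expr.Fits, Expr.eval, State.reg_setArr, State.reg_setReg, if_true, q7]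
        omega
      · simp only [Expr.Fits, Expr.eval, Op.eval, State.reg_setArr, State.reg_setReg, if_true, q7,
          State.arr_setReg, State.arr_setArr, qa]
        simp [hph]
        omega
      · simp only [Expr.eval, Op.eval, State.reg_setArr, State.reg_setReg, if_true, q4, q6, q7,
          State.arr_setReg, State.arr_setArr, qa]
        refine ⟨((p₁.setArr (by omega) _ _).setReg (by omega) _).setArr (by omega) _ _, ?_, ?_⟩
        · simp [q3]
        · rw [hstep]
          refine ⟨fun j hj => ?_, fun y => ?_, ?_, ?_⟩
          · have := hgs.ptr j hj
            simp only [State.arr_setArr, State.arr_setReg, qa, Function.update_apply]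
            simp [hph, this]
          · have := hgs.hold y
            simp only [State.arr_setArr, State.arr_setReg, qa, Function.update_apply, Fin.val_inj]
            simp [this]
          · simp [State.reg_setArr, State.reg_setReg]
          · simp [State.reg_setArr, State.reg_setReg, q5]
    · intro hlt
      simp only [Expr.eval, Op.eval, q0, q4, q6, q7, qa, k1, k2,
        ite_eq_right_iff, one_ne_zero, imp_false] at hlt
      rw [if_neg hlt] at hstep
      refine RunsIn.skip (by simp [Expr.cost]) (RunsIn.write ?_ ?_ (by simp [Expr.cost]) ?_)
      · simp only [Expr.Fits, q4]
        omega
      · simp only [Expr.Fits, Expr.eval, Op.eval, q4, qa, hpc]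
        omega
      · simp only [Expr.eval, Op.eval, q4, qa, hpc]
        refine ⟨p₁.setArr (by omega) _ _, q3, ?_⟩
        rw [hstep]
        refine ⟨fun j hj => ?_, fun y => ?_, q4, q5⟩
        · have := hgs.ptr j hj
          simp [State.arr_setArr, qa, Function.update_apply, this]
        · have := hgs.hold y
          simp [State.arr_setArr, qa, this]
  · intro htest
    simp only [Expr.eval, Op.eval, r0, r4, hpc, ite_eq_right_iff, one_ne_zero, imp_false] at htest
    have hstep : g.step P =
        if g.next < n then { g with cand := g.next, next := g.next + 1 } else g := by
      unfold Config.step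
      rw [dif_neg fun h => htest h.2]
    refine RunsIn.cond ?_ (by simp [Expr.cost]) ?_ ?_
    · simp only [Expr.Fits, Expr.eval, Op.eval, r0, r5]
      exact ⟨by omega, by omega, (ite_one_zero_le _).trans (by omega)⟩
    · intro hlt
      simp only [Expr.eval, Op.eval, r0, r5, ne_eq, ite_eq_right_iff, one_ne_zero, imp_false,
        not_not] at hlt
      rw [if_pos hlt] at hstep
      refine RunsIn.assign_seq ?_ (by simp [Expr.cost]) (RunsIn.assign ?_ (by simp [Expr.cost]) ?_)
      · simp only [Expr.Fits, r5]
        omega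
      · simp [Expr.Fits, Expr.eval, Op.eval, State.reg_setReg, r5]
        omega
      · refine ⟨(hs.setReg (by omega) _).setReg (by omega) _, by simp [State.reg_setReg, ht], ?_⟩
        rw [hstep]
        refine ⟨hgs.ptr, hgs.hold, ?_, ?_⟩ <;>
          simp [State.reg_setReg, Expr.eval, Op.eval, r5]
    · intro hlt
      simp only [Expr.eval, Op.eval, r0, r5, ite_eq_right_iff, one_ne_zero, imp_false] at hlt
      rw [if_neg hlt] at hstep
      refine RunsIn.skip (by simp [Expr.cost]) ⟨hs, ht, ?_⟩
      rwa [hstep]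

theorem runsIn_passProg (P : Profile n) (m : Fin n) {B : ℕ} (hB : 20 * (n * n) ≤ B) {s : State}
    (hs : InputKept P m s) (hr : HasRanks P n s) :
    RunsIn B passProg s (600 * n ^ 3) (PassInv P m n) := by
  have hn : 0 < n := m.pos
  have hnn : n ≤ n * n := Nat.le_mul_self n
  -- The three summands pay for `startProg`, for `4 * (n * n)` steps of cost at most `60` with a
  -- loop bound of cost `5`, and for recording the answer.
  refine (RunsIn.forLoop (N := n) (T := 50 * n + (4 * (n * n) * (60 + 5 + 7) + 5 + 5) + 10)
    (PassInv P m) (by omega) ?_ ?_ ?_).mono ?_ fun _ h => h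
  · exact ⟨hs.setReg le_rfl 0, hr, by simp [State.reg_setReg],
      fun w hw => absurd hw (Nat.not_lt_zero _), fun w hw => absurd hw (Nat.not_lt_zero _)⟩
  · rintro k s h
    refine ⟨h.counter, ?_, h.input.reg_zero⟩
    simp only [Expr.Fits, h.input.reg_zero]
    omega
  · rintro w s hw h
    set w' : Fin n := ⟨w, hw⟩ with hw'
    refine RunsIn.seq (50 * n) ((4 * (n * n) * (60 + 5 + 7) + 5 + 5) + 10) (by omega)
      ((runsIn_startProg P m w' hB h).mono le_rfl ?_)
    rintro s ⟨h1, h2⟩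
    refine RunsIn.seq (4 * (n * n) * (60 + 5 + 7) + 5 + 5) 10 (by omega)
      ((RunsIn.forLoop (N := 4 * (n * n)) (T := 60)
        (fun t s => PassInv P m w s ∧ s.reg 3 = t ∧
          ((Config.step P)^[t] (Config.start m w')).Stored s) (by omega) ?_ ?_ ?_).mono
        (by simp [Expr.cost]) ?_)
    · exact ⟨h1.setReg (by omega) 0, by simp [State.reg_setReg], h2.ptr, h2.hold,
        by simpa [State.reg_setReg] using h2.cand, by simpa [State.reg_setReg] using h2.next⟩
    · rintro k s ⟨h1, h2, -⟩
      simp only [Expr.Fits, Expr.eval, Op.eval, h1.input.reg_zero]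
      exact ⟨h2, by omega, trivial⟩
    · rintro t s ht ⟨h1, h2, h3⟩
      refine (runsIn_stepProg hB h1 (Config.inv_iterate P m w' t) h3 (fun j => ?_) h2).mono
        le_rfl ?_
      · have := Config.ptr_iterate_le P m w' t j
        omega
      · rintro s' ⟨h1, h2, h3⟩
        rw [← Function.iterate_succ_apply' (Config.step P) t] at h3
        exact ⟨h2, h1.setReg (by omega) _, by simp [State.reg_setReg], h3.ptr, h3.hold,
          by simpa [State.reg_setReg] using h3.cand, by simpa [State.reg_setReg] using h3.next⟩
    · rintro s ⟨h1, -, h3⟩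
      -- For `n` at least `1`, `4 * (n * n)` exceeds the bound `n * n + 2 * n` on the potential.
      have hdone : ((Config.step P)^[4 * (n * n)] (Config.start m w')).Done :=
        Config.done_iterate P m w' (by omega)
      have hinv := Config.inv_iterate P m w' (4 * (n * n))
      have hiff := hinv.hold_ne_iff hdone
      have hle := hinv.hold_le w'
      have h7 := h3.hold w'
      generalize (Config.step P)^[4 * (n * n)] (Config.start m w') = g at h3 hiff hle h7
      have r0 := h1.input.reg_zero
      have r1 := h1.input.reg_one
      have r2 := h1.counter
      have hm := m.is_lt
      have h7' : s.arr 7 w = g.hold w' := h7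
      have hext : ∀ v, (w' ∈ passSet P m → v = 1) → (w' ∉ passSet P m → v = 0) →
          (s.setArr 5 w v).reg 2 = w ∧
          PassInv P m (w + 1) ((s.setArr 5 w v).setReg 2 (w + 1)) := by
        intro v hv1 hv2
        refine ⟨r2, (h1.input.setArr (by omega) _ _).setReg (by omega) _, ?_,
          by simp [State.reg_setReg], ?_, ?_⟩
        · intro x hx j hj
          rw [State.arr_setReg, State.arr_setArr, if_neg (by omega)]
          exact h1.ranks x hx j hj
        · intro x hx hmem
          rw [State.arr_setReg, State.arr_setArr]
          rcases Nat.lt_succ_iff_lt_or_eq.1 hx with h | h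
          · rw [if_neg (by omega)]
            exact h1.mem x h hmem
          · rw [if_pos ⟨rfl, h⟩]
            have : x = w' := Fin.ext h
            exact hv1 (this ▸ hmem)
        · intro x hx hmem
          rw [State.arr_setReg, State.arr_setArr]
          rcases Nat.lt_succ_iff_lt_or_eq.1 hx with h | h
          · rw [if_neg (by omega)]
            exact h1.notMem x h hmem
          · rw [if_pos ⟨rfl, h⟩]
            have : x = w' := Fin.ext h
            exact hv2 (this ▸ hmem)
      refine RunsIn.cond ?_ (by simp [Expr.cost]) ?_ ?_
      · simp only [Expr.Fits, Expr.eval, Op.eval, r1, r2, h7']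
        exact ⟨by omega, by omega, (ite_one_zero_le _).trans (by omega)⟩
      · intro heq
        simp only [Expr.eval, Op.eval, r1, r2, h7', ne_eq, ite_eq_right_iff, one_ne_zero,
          imp_false, not_not] at heq
        refine RunsIn.write ?_ ?_ (by simp [Expr.cost]) ?_
        · simp only [Expr.Fits, r2]
          omega
        · simp only [Expr.Fits]
          omega
        · simp only [Expr.eval, r2]
          exact hext 0 (fun h => absurd heq (hiff.2 h)) fun _ => rfl
      · intro heq
        simp only [Expr.eval, Op.eval, r1, r2, h7', ite_eq_right_iff, one_ne_zero,
          imp_false] at heq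
        refine RunsIn.write ?_ ?_ (by simp [Expr.cost]) ?_
        · simp only [Expr.Fits, r2]
          omega
        · simp only [Expr.Fits]
          omega
        · simp only [Expr.eval, r2]
          exact hext 1 (fun _ => rfl) fun h => absurd (hiff.1 heq) h
  · simp only [Expr.cost]
    have e1 : n ^ 3 = n * (n * n) := by ring
    have e2 : n * n ≤ n * (n * n) := Nat.mul_le_mul_left n hnn
    have e3 : n * (50 * n + (4 * (n * n) * (60 + 5 + 7) + 5 + 5) + 10 + 1 + 7) =
      50 * (n * n) + 288 * (n * (n * n)) + 28 * n := by ring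
    omega

/-! ### The list that pushes up the no-regret set -/

/-- Sorting key: the women who reject `m` come first, otherwise the true list of `m` counts. -/
noncomputable def pushKey (P : Profile n) (m w : Fin n) : ℕ :=
  open Classical in (if w ∈ passSet P m then 0 else n) + (((P.men m).symm w : Fin n) : ℕ)

theorem pushKey_of_mem {P : Profile n} {m w : Fin n} (h : w ∈ passSet P m) :
    pushKey P m w = (((P.men m).symm w : Fin n) : ℕ) := by
  simp [pushKey, h]

theorem pushKey_of_notMem {P : Profile n} {m w : Fin n} (h : w ∉ passSet P m) :
    pushKey P m w = n + (((P.men m).symm w : Fin n) : ℕ) := by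
  simp [pushKey, h]

theorem pushKey_injective (P : Profile n) (m : Fin n) : Function.Injective (pushKey P m) := by
  intro a b hab
  apply (P.men m).symm.injective
  apply Fin.ext
  have ha := ((P.men m).symm a).is_lt
  have hb := ((P.men m).symm b).is_lt
  by_cases h1 : a ∈ passSet P m <;> by_cases h2 : b ∈ passSet P m <;>
    simp only [pushKey, h1, h2, if_true, if_false] at hab <;> omega

theorem pushKey_le (P : Profile n) (m w : Fin n) : pushKey P m w ≤ 2 * n := by
  have := ((P.men m).symm w).is_lt
  unfold pushKey
  split_ifs <;> omega

/-- Among the women outside `passSet`, `DA P m` is the one whom `m` likes best, hence the one with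
the least key. -/
theorem pushKey_lt_DA_iff (P : Profile n) (m w : Fin n) :
    pushKey P m w < pushKey P m (DA P m) ↔ w ∈ passSet P m := by
  rw [pushKey_of_notMem (DA_notMem_passSet P m)]
  constructor
  · intro h
    by_contra hw
    rw [pushKey_of_notMem hw] at h
    refine hw (mem_passSet_of_prefers_DA P m ?_)
    have : (((P.men m).symm w : Fin n) : ℕ) < (P.men m).symm (DA P m) := by omega
    exact this
  · intro h
    rw [pushKey_of_mem h]
    omega

/-- The number of agents with a smaller key. -/
def keyRank (f : Fin n → ℕ) (w : Fin n) : ℕ := (Finset.univ.filter fun v => f v < f w).card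

theorem keyRank_lt_of_lt {f : Fin n → ℕ} {a b : Fin n} (h : f a < f b) :
    keyRank f a < keyRank f b := by
  refine Finset.card_lt_card (Finset.ssubset_iff_subset_ne.2
    ⟨Finset.monotone_filter_right Finset.univ fun v _ hv => hv.trans h, fun heq => ?_⟩)
  have : a ∈ Finset.univ.filter fun v => f v < f b := by simpa using h
  rw [← heq] at this
  simp at this

theorem keyRank_lt (f : Fin n → ℕ) (w : Fin n) : keyRank f w < n := by
  have : (Finset.univ.filter fun v => f v < f w) ⊂ Finset.univ :=
    Finset.filter_ssubset.2 ⟨w, Finset.mem_univ w, lt_irrefl _⟩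
  simpa [keyRank] using Finset.card_lt_card this

theorem keyRank_injective {f : Fin n → ℕ} (hf : Function.Injective f) :
    Function.Injective (keyRank f) := by
  intro a b hab
  rcases lt_trichotomy (f a) (f b) with h | h | h
  · exact absurd hab (keyRank_lt_of_lt h).ne
  · exact hf h
  · exact absurd hab (keyRank_lt_of_lt h).ne'

/-- The list ordered by an injective key. -/
theorem exists_prefList_keyRank {f : Fin n → ℕ} (hf : Function.Injective f) :
    ∃ σ : PrefList n, ∀ w, ((σ.symm w : Fin n) : ℕ) = keyRank f w := by
  have hbij : Function.Bijective fun w => (⟨keyRank f w, keyRank_lt f w⟩ : Fin n) :=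
    Finite.injective_iff_bijective.1 fun a b hab => keyRank_injective hf (congrArg Fin.val hab)
  exact ⟨(Equiv.ofBijective _ hbij).symm, fun w => rfl⟩

/-- Array `8` gets the sorting keys, array `3` the indicator function of the no-regret set. -/
def keyProg : Prog :=
  .seq (.assign 4 (.lit 0))
    (.forLoop 2 (.reg 0) (.seq (.assign 5 (.read 0 (.cell (.reg 0) (.reg 1) (.reg 2))))
      (.cond (.read 5 (.reg 5))
        (.seq (.write 8 (.reg 5) (.reg 2)) (.write 3 (.reg 5) (.lit 1)))
        (.seq (.write 8 (.reg 5) (.bin .add (.reg 0) (.reg 2)))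
          (.seq (.write 3 (.reg 5) (.bin .sub (.lit 1) (.reg 4))) (.assign 4 (.lit 1)))))))

/-- Array `2` gets the women sorted by their keys in array `8`. -/
def sortProg : Prog :=
  .forLoop 2 (.reg 0) (.seq (.assign 4 (.lit 0)) (.seq
    (.forLoop 3 (.reg 0)
      (.assign 4 (.bin .add (.reg 4) (.bin .lt (.read 8 (.reg 3)) (.read 8 (.reg 2))))))
    (.write 2 (.reg 4) (.reg 2))))

/-- The first `k` women in the list of `m` have their cells in arrays `3` and `8`. -/
structure KeyInv (P : Profile n) (m : Fin n) (k : ℕ) (s : State) : Prop where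
  input : InputKept P m s
  counter : s.reg 2 = k
  flag : s.reg 4 = if (((P.men m).symm (DA P m) : Fin n) : ℕ) < k then 1 else 0
  pass_mem : ∀ w : Fin n, w ∈ passSet P m → s.arr 5 w = 1
  pass_notMem : ∀ w : Fin n, w ∉ passSet P m → s.arr 5 w = 0
  key : ∀ w : Fin n, (((P.men m).symm w : Fin n) : ℕ) < k → s.arr 8 w = pushKey P m w
  mem : ∀ w : Fin n, (((P.men m).symm w : Fin n) : ℕ) < k → w ∈ noRegretSet P m → s.arr 3 w = 1
  notMem : ∀ w : Fin n, (((P.men m).symm w : Fin n) : ℕ) < k → w ∉ noRegretSet P m →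
    s.arr 3 w = 0

/-- Effect of the loop body of `keyProg` on the woman `w` in position `k`. -/
theorem KeyInv.extend {P : Profile n} {m : Fin n} {k : ℕ} {s s' : State} (h : KeyInv P m k s)
    {w : Fin n} (hw : (((P.men m).symm w : Fin n) : ℕ) = k)
    (hr : ∀ y, y < 3 → s'.reg y = s.reg y)
    (ha : ∀ a, a ≠ 3 → a ≠ 8 → s'.arr a = s.arr a)
    (h8 : ∀ v : Fin n, s'.arr 8 v = if v = w then pushKey P m w else s.arr 8 v)
    (h3 : ∀ v : Fin n, v ≠ w → s'.arr 3 v = s.arr 3 v)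
    (hmem : w ∈ noRegretSet P m → s'.arr 3 w = 1)
    (hnot : w ∉ noRegretSet P m → s'.arr 3 w = 0)
    (h4 : s'.reg 4 = if (((P.men m).symm (DA P m) : Fin n) : ℕ) < k + 1 then 1 else 0) :
    s'.reg 2 = k ∧ KeyInv P m (k + 1) (s'.setReg 2 (k + 1)) := by
  have hlt : ∀ v : Fin n, v ≠ w → (((P.men m).symm v : Fin n) : ℕ) < k + 1 →
      (((P.men m).symm v : Fin n) : ℕ) < k := by
    intro v hv h
    refine lt_of_le_of_ne (Nat.lt_succ_iff.1 h) fun heq => hv ?_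
    exact (P.men m).symm.injective (Fin.ext (heq.trans hw.symm))
  have hin : InputKept P m s' :=
    ⟨(hr 0 (by omega)).trans h.input.reg_zero, (hr 1 (by omega)).trans h.input.reg_one,
      (ha 0 (by omega) (by omega)).trans h.input.arr_zero,
      (ha 1 (by omega) (by omega)).trans h.input.arr_one⟩
  have h5 : s'.arr 5 = s.arr 5 := ha 5 (by omega) (by omega)
  refine ⟨(hr 2 (by omega)).trans h.counter, hin.setReg le_rfl _, by simp [State.reg_setReg],
    ?_, ?_, ?_, ?_, ?_, ?_⟩
  · rw [State.reg_setReg_of_ne _ _ (by omega), h4]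
  · intro v hv
    rw [State.arr_setReg, h5, h.pass_mem v hv]
  · intro v hv
    rw [State.arr_setReg, h5, h.pass_notMem v hv]
  · intro v hv
    rw [State.arr_setReg, h8]
    split_ifs with hvw
    · rw [hvw]
    · exact h.key v (hlt v hvw hv)
  · intro v hv hX
    rw [State.arr_setReg]
    by_cases hvw : v = w
    · subst hvw
      exact hmem hX
    · rw [h3 v hvw, h.mem v (hlt v hvw hv) hX]
  · intro v hv hX
    rw [State.arr_setReg]
    by_cases hvw : v = w
    · subst hvw
      exact hnot hX
    · rw [h3 v hvw, h.notMem v (hlt v hvw hv) hX]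

/-- The program never computes `DA P m` separately: she is the first woman outside `passSet` in the
true list. Register `4` tells whether she has been passed, and `1` minus this flag is the indicator
of the no-regret set on the women outside `passSet`. -/
theorem runsIn_keyProg (P : Profile n) (m : Fin n) {B : ℕ} (hB : 20 * (n * n) ≤ B) {s : State}
    (hs : PassInv P m n s) : RunsIn B keyProg s (100 * n) (KeyInv P m n) := by
  have hn : 0 < n := m.pos
  have hnn : n ≤ n * n := Nat.le_mul_self n
  have hm := m.is_lt
  refine RunsIn.seq 2 (50 * n + 10) (by omega)
    (RunsIn.assign (by simp [Expr.Fits]) (by simp [Expr.cost])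
    ((RunsIn.forLoop (N := n) (T := 40) (KeyInv P m) (by omega) ?_ ?_ ?_).mono ?_ fun _ h => h))
  · simp only [Expr.eval]
    refine ⟨(hs.input.setReg (by omega) _).setReg le_rfl _, ?_, ?_, ?_, ?_, ?_, ?_, ?_⟩
    · simp [State.reg_setReg]
    · simp [State.reg_setReg]
    · exact fun w hw => hs.mem w w.is_lt hw
    · exact fun w hw => hs.notMem w w.is_lt hw
    all_goals exact fun w hw => absurd hw (Nat.not_lt_zero _)
  · intro k s h
    refine ⟨h.counter, ?_, h.input.reg_zero⟩
    simp only [Expr.Fits, h.input.reg_zero]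
    omega
  · intro k s hk h
    have r0 := h.input.reg_zero
    have r1 := h.input.reg_one
    have r2 := h.counter
    have r4 := h.flag
    have a0 := h.input.arr_zero
    set w := P.men m ⟨k, hk⟩ with hwdef
    have hw : (P.men m).symm w = ⟨k, hk⟩ := by simp [hwdef]
    have hwk : (((P.men m).symm w : Fin n) : ℕ) = k := congrArg Fin.val hw
    have hcell : table P.men (m * n + k) = w := table_apply _ hm hk
    have hwn := w.is_lt
    have b1 := row_le hm hk.le
    refine RunsIn.assign_seq ?_ (by simp [Expr.cost, Expr.cell]) ?_
    · simp only [Expr.Fits, Expr.eval, Op.eval, Expr.cell, r0, r1, r2, a0, hcell]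
      omega
    simp only [Expr.eval, Op.eval, Expr.cell, r0, r1, r2, a0, hcell]
    by_cases hpass : w ∈ passSet P m
    · have h5 := h.pass_mem w hpass
      have hd : (((P.men m).symm (DA P m) : Fin n) : ℕ) ≠ k := by
        intro hd
        have : DA P m = w := (P.men m).symm.injective (Fin.ext (hd.trans hwk.symm))
        exact DA_notMem_passSet P m (this ▸ hpass)
      refine RunsIn.cond ?_ (by simp [Expr.cost]) (fun _ => ?_) fun h0 => ?_
      · simp only [Expr.Fits, Expr.eval, State.reg_setReg, State.arr_setReg, if_true, h5]
        omega
      · refine RunsIn.write_seq ?_ ?_ (by simp [Expr.cost])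
          (RunsIn.write ?_ ?_ (by simp [Expr.cost]) ?_)
        · simp [Expr.Fits, State.reg_setReg]
          omega
        · simp [Expr.Fits, State.reg_setReg]
          omega
        · simp [Expr.Fits, State.reg_setReg, State.reg_setArr]
          omega
        · simp [Expr.Fits]
          omega
        · have hX : w ∈ noRegretSet P m := by
            rw [noRegretSet_eq]
            exact Or.inr hpass
          refine h.extend hwk (fun y hy => ?_) (fun a h3 h8 => ?_) (fun v => ?_) (fun v hv => ?_)
            (fun _ => ?_) (fun hX' => absurd hX hX') ?_
          · simp only [State.reg_setArr]
            exact State.reg_setReg_of_ne _ _ (by omega)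
          · rw [State.arr_setArr_of_ne _ _ _ h3, State.arr_setArr_of_ne _ _ _ h8, State.arr_setReg]
          · rw [pushKey_of_mem hpass, hwk]
            simp [State.arr_setArr, State.arr_setReg, State.reg_setReg, Expr.eval, r2, Fin.val_inj]
          · simp [State.arr_setArr, State.arr_setReg, State.reg_setReg, State.reg_setArr, Expr.eval,
              Fin.val_inj, hv]
          · simp [State.arr_setArr, State.reg_setReg, State.reg_setArr, Expr.eval]
          · simp only [State.reg_setArr, State.reg_setReg_of_ne _ _ (show 4 ≠ 5 by omega), r4]
            split_ifs <;> omega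
      · simp [Expr.eval, State.reg_setReg, State.arr_setReg, h5] at h0
    · have h5 := h.pass_notMem w hpass
      have hd : (((P.men m).symm (DA P m) : Fin n) : ℕ) ≤ k := by
        by_contra hd
        refine hpass (mem_passSet_of_prefers_DA P m ?_)
        have : (((P.men m).symm w : Fin n) : ℕ) < (P.men m).symm (DA P m) := by omega
        exact this
      have hX : w ∈ noRegretSet P m ↔ (((P.men m).symm (DA P m) : Fin n) : ℕ) = k := by
        rw [noRegretSet_eq, Set.mem_insert_iff]
        constructor
        · rintro (h | h)
          · rw [← h, hwk]
          · exact absurd h hpass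
        · intro h
          exact Or.inl ((P.men m).symm.injective (Fin.ext (hwk.trans h.symm)))
      refine RunsIn.cond ?_ (by simp [Expr.cost]) (fun h0 => ?_) fun _ => ?_
      · simp only [Expr.Fits, Expr.eval, State.reg_setReg, State.arr_setReg, if_true, h5]
        omega
      · simp [Expr.eval, State.reg_setReg, State.arr_setReg, h5] at h0
      · refine RunsIn.write_seq ?_ ?_ (by simp [Expr.cost])
          (RunsIn.write_seq ?_ ?_ (by simp [Expr.cost])
            (RunsIn.assign ?_ (by simp [Expr.cost]) ?_))
        · simp [Expr.Fits, State.reg_setReg]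
          omega
        · simp [Expr.Fits, Expr.eval, Op.eval, State.reg_setReg, r0, r2]
          omega
        · simp [Expr.Fits, State.reg_setReg, State.reg_setArr]
          omega
        · simp only [Expr.Fits, Expr.eval, Op.eval, State.reg_setArr,
            State.reg_setReg_of_ne _ _ (show 4 ≠ 5 by omega), r4]
          have := ite_one_zero_le ((((P.men m).symm (DA P m) : Fin n) : ℕ) < k)
          omega
        · simp [Expr.Fits]
          omega
        · refine h.extend hwk (fun y hy => ?_) (fun a h3 h8 => ?_) (fun v => ?_) (fun v hv => ?_)
            (fun hmem => ?_) (fun hmem => ?_) ?_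
          · rw [State.reg_setReg_of_ne _ _ (by omega), State.reg_setArr, State.reg_setArr]
            exact State.reg_setReg_of_ne _ _ (by omega)
          · rw [State.arr_setReg, State.arr_setArr_of_ne _ _ _ h3, State.arr_setArr_of_ne _ _ _ h8,
              State.arr_setReg]
          · rw [pushKey_of_notMem hpass, hwk]
            simp [State.arr_setArr, State.arr_setReg, State.reg_setReg, Expr.eval, Op.eval, r0, r2,
              Fin.val_inj]
          · simp [State.arr_setArr, State.arr_setReg, State.reg_setReg, State.reg_setArr, Expr.eval,
              Fin.val_inj, hv]
          · rw [hX] at hmem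
            simp [State.arr_setArr, State.arr_setReg, State.reg_setReg, State.reg_setArr, Expr.eval,
              Op.eval, r4, hmem]
          · rw [hX] at hmem
            simp [State.arr_setArr, State.arr_setReg, State.reg_setReg, State.reg_setArr, Expr.eval,
              Op.eval, r4, lt_of_le_of_ne hd hmem]
          · simp only [Expr.eval]
            rw [State.reg_setReg, if_pos rfl, if_pos (by omega)]
  · simp only [Expr.cost]
    omega

/-- Each woman goes to the cell given by the number of smaller keys. Injectivity makes these cells
distinct, so no entry is overwritten. -/
theorem runsIn_sortProg {f : Fin n → ℕ} (hf : Function.Injective f) (hfn : ∀ w, f w ≤ 2 * n)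
    {B : ℕ} (hn : 0 < n) (hB : 20 * (n * n) ≤ B) {s : State} (h0 : s.reg 0 = n)
    (h8 : ∀ w : Fin n, s.arr 8 w = f w) :
    RunsIn B sortProg s (100 * (n * n)) fun s' =>
      s'.arr 3 = s.arr 3 ∧ ∀ w : Fin n, s'.arr 2 (keyRank f w) = w := by
  have hnn : n ≤ n * n := Nat.le_mul_self n
  set a3 := s.arr 3
  refine (RunsIn.forLoop (N := n) (T := 20 * n + 20) (fun k s => s.reg 0 = n ∧ s.reg 2 = k ∧
    (∀ w : Fin n, s.arr 8 w = f w) ∧ s.arr 3 = a3 ∧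
    ∀ w : Fin n, (w : ℕ) < k → s.arr 2 (keyRank f w) = w) (by omega) ?_ ?_ ?_).mono ?_ ?_
  · exact ⟨by simp [State.reg_setReg, h0], by simp [State.reg_setReg], h8, rfl,
      fun w hw => absurd hw (Nat.not_lt_zero _)⟩
  · rintro k s ⟨h1, h2, -⟩
    refine ⟨h2, ?_, h1⟩
    simp only [Expr.Fits, h1]
    omega
  · rintro w s hw ⟨h1, h2, h3, h4, h5⟩
    set w' : Fin n := ⟨w, hw⟩ with hw'
    refine RunsIn.assign_seq (by simp [Expr.Fits]) (by simp [Expr.cost]) ?_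
    refine RunsIn.seq (20 * n + 10) 5 (by simp [Expr.cost]) ((RunsIn.forLoop (N := n) (T := 10)
      (fun k s => s.reg 0 = n ∧ s.reg 2 = w ∧ s.reg 3 = k ∧ (∀ w : Fin n, s.arr 8 w = f w) ∧
        s.arr 3 = a3 ∧ (∀ w' : Fin n, (w' : ℕ) < w → s.arr 2 (keyRank f w') = w') ∧
        s.reg 4 = (Finset.univ.filter fun v : Fin n => (v : ℕ) < k ∧ f v < f w').card)
      (by omega) ?_ ?_ ?_).mono ?_ ?_)
    · refine ⟨?_, ?_, ?_, h3, h4, h5, ?_⟩ <;> simp [State.reg_setReg, Expr.eval, h1, h2]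
    · rintro k s ⟨h1, -, h3, -⟩
      refine ⟨h3, ?_, h1⟩
      simp only [Expr.Fits, h1]
      omega
    · rintro k s hk ⟨h1, h2, h3, h4, h5, h6, h7⟩
      set k' : Fin n := ⟨k, hk⟩ with hk'
      have e1 : s.arr 8 k = f k' := h4 k'
      have e2 : s.arr 8 w = f w' := h4 w'
      have l1 := hfn k'
      have l2 := hfn w'
      have hle : s.reg 4 ≤ n := by
        rw [h7]
        simpa using (Finset.univ.filter fun v : Fin n => (v : ℕ) < k ∧ f v < f w').card_le_univ
      have hite := ite_one_zero_le (f k' < f w')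
      have hcard : (Finset.univ.filter fun v : Fin n => (v : ℕ) < k + 1 ∧ f v < f w').card =
          s.reg 4 + if f k' < f w' then 1 else 0 := by
        rw [h7]
        by_cases hlt : f k' < f w'
        · rw [if_pos hlt, ← Finset.card_insert_of_notMem (a := k') (by simp [hk'])]
          congr 1
          ext v
          simp only [Finset.mem_filter, Finset.mem_univ, true_and, Finset.mem_insert]
          constructor
          · rintro ⟨hv1, hv2⟩
            rcases Nat.lt_succ_iff_lt_or_eq.1 hv1 with h | h
            · exact Or.inr ⟨h, hv2⟩
            · exact Or.inl (Fin.ext h)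
          · rintro (rfl | ⟨hv1, hv2⟩)
            · exact ⟨Nat.lt_succ_self k, hlt⟩
            · exact ⟨by omega, hv2⟩
        · rw [if_neg hlt, add_zero]
          congr 1
          ext v
          simp only [Finset.mem_filter, Finset.mem_univ, true_and]
          constructor
          · rintro ⟨hv1, hv2⟩
            refine ⟨lt_of_le_of_ne (Nat.lt_succ_iff.1 hv1) fun h => hlt ?_, hv2⟩
            have : v = k' := Fin.ext h
            exact this ▸ hv2
          · rintro ⟨hv1, hv2⟩
            exact ⟨by omega, hv2⟩
      refine RunsIn.assign ?_ (by simp [Expr.cost]) ?_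
      · simp only [Expr.Fits, Expr.eval, Op.eval, h2, h3, e1, e2]
        omega
      · simp only [Expr.eval, Op.eval, h2, h3, e1, e2]
        refine ⟨?_, ?_, ?_, ?_, h4, h5, h6, ?_⟩
        · simp [State.reg_setReg, h3]
        · simp [State.reg_setReg, h1]
        · simp [State.reg_setReg, h2]
        · simp [State.reg_setReg]
        · rw [hcard]
          simp [State.reg_setReg]
    · simp only [Expr.cost]
      omega
    · rintro s ⟨h1, h2, -, h4, h5, h6, h7⟩
      have hrank : s.reg 4 = keyRank f w' := by
        rw [h7]
        simp [keyRank]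
      have hlt := keyRank_lt f w'
      refine RunsIn.write ?_ ?_ (by simp [Expr.cost]) ?_
      · simp only [Expr.Fits]
        omega
      · simp only [Expr.Fits]
        omega
      · simp only [Expr.eval, h2, hrank]
        refine ⟨h2, ?_, by simp [State.reg_setReg], ?_, ?_, ?_⟩
        · simp [State.reg_setReg, State.reg_setArr, h1]
        · intro v
          rw [State.arr_setReg, State.arr_setArr_of_ne _ _ _ (by omega), h4]
        · rw [State.arr_setReg, State.arr_setArr_of_ne _ _ _ (by omega), h5]
        · intro v hv
          rw [State.arr_setReg, State.arr_setArr]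
          rcases Nat.lt_succ_iff_lt_or_eq.1 hv with h | h
          · rw [if_neg, h6 v h]
            rintro ⟨-, heq⟩
            have := congrArg Fin.val (keyRank_injective hf heq)
            simp only [hw'] at this
            omega
          · have : v = w' := Fin.ext h
            subst this
            simp [hw']
  · simp only [Expr.cost]
    nlinarith
  · rintro s ⟨-, -, -, h4, h5⟩
    exact ⟨h4, fun w => h5 w w.is_lt⟩

end OneForAll

/-! ### The complete program -/

theorem mainTheorem4 :
    ∃ (prog : OneForAll.Prog) (C : ℕ),
      ∀ (n : ℕ) (P : OneForAll.Profile n) (m : Fin n),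
        ∃ (s : OneForAll.State) (t : ℕ) (σ : OneForAll.PrefList n),
          OneForAll.Exec (C * n ^ 2) prog (OneForAll.inputState P m) s t ∧
          t ≤ C * n ^ 3 ∧
          OneForAll.OutputsList s σ ∧
          OneForAll.OutputsSet s (OneForAll.noRegretSet P m) ∧
          OneForAll.IsPushUp P m (OneForAll.noRegretSet P m) σ ∧
          OneForAll.IsOptimalStrategy P m σ := by
  open OneForAll in
  -- The constant is generous: the parts need words up to `20 * (n * n)` and at most `100 * (n *
  -- n)`, `600 * n ^ 3`, `100 * n` and `100 * (n * n)` steps. The existence of `m` gives `0 < n`,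
  -- which lets the cubic term absorb the others.
  refine ⟨.seq rankProg (.seq passProg (.seq keyProg sortProg)), 1000, fun n P m => ?_⟩
  have hn : 0 < n := m.pos
  have hB : 20 * (n * n) ≤ 1000 * n ^ 2 := by nlinarith
  have hnn : n ≤ n * n := Nat.le_mul_self n
  have hn3 : n * n ≤ n ^ 3 := by
    have : n ^ 3 = n * (n * n) := by ring
    rw [this]
    exact Nat.mul_le_mul_left n hnn
  have hinj := pushKey_injective P m
  obtain ⟨σ, hσ⟩ := exists_prefList_keyRank hinj
  have hrun : RunsIn (1000 * n ^ 2) (.seq rankProg (.seq passProg (.seq keyProg sortProg)))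
      (inputState P m) (1000 * n ^ 3) fun s =>
        OutputsSet s (noRegretSet P m) ∧ ∀ w : Fin n, s.arr 2 (keyRank (pushKey P m) w) = w := by
    refine RunsIn.seq (100 * (n * n)) (900 * n ^ 3) (by omega)
      ((runsIn_rankProg P m hB (inputKept_inputState P m)).mono le_rfl ?_)
    rintro s ⟨h1, h2⟩
    refine RunsIn.seq (600 * n ^ 3) (300 * n ^ 3) (by omega)
      ((runsIn_passProg P m hB h1 h2).mono le_rfl fun s h => ?_)
    refine RunsIn.seq (100 * n) (100 * (n * n)) (by omega)
      ((runsIn_keyProg P m hB h).mono le_rfl fun s h => ?_)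
    refine (runsIn_sortProg hinj (pushKey_le P m) hn hB h.input.reg_zero
      fun w => h.key w (Fin.is_lt _)).mono le_rfl ?_
    rintro s' ⟨h3, h2⟩
    refine ⟨fun w => ⟨fun hw => ?_, fun hw => ?_⟩, h2⟩
    · rw [h3, h.mem w (Fin.is_lt _) hw]
    · rw [h3, h.notMem w (Fin.is_lt _) hw]
  obtain ⟨s, t, h1, h2, h3, h4⟩ := hrun
  have hpre : ∀ w, PrefList.Prefers σ w (DA P m) ↔ w ∈ passSet P m := by
    intro w
    rw [← pushKey_lt_DA_iff]
    have hval : PrefList.Prefers σ w (DA P m) ↔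
        ((σ.symm w : Fin n) : ℕ) < ((σ.symm (DA P m) : Fin n) : ℕ) := Iff.rfl
    rw [hval, hσ, hσ]
    refine ⟨fun h => ?_, keyRank_lt_of_lt⟩
    by_contra hcon
    rcases (not_lt.1 hcon).lt_or_eq with hlt | heq
    · exact absurd (keyRank_lt_of_lt hlt) h.not_gt
    · rw [hinj heq] at h
      exact lt_irrefl _ h
  obtain ⟨h5, h6⟩ := isPushUp_and_isOptimalStrategy P m σ hpre
  refine ⟨s, t, σ, h1, h2, fun k => ?_, h3, h5, h6⟩
  -- The sorted array is known at the cell `keyRank` of each woman; for the woman `σ k` this cell is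
  -- `k`.
  have := h4 (σ k)
  rwa [← hσ, Equiv.symm_apply_apply] at this
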